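/- Let $\mathbb H=\{z\in\mathbb C:\operatorname{Im} z>0\}$ and write $f^n$ for the $n$-th iterate of $f\colon\mathbb H\to\mathbb H$. A holomorphic map $f\colon\mathbb H\to\mathbb H$ is called parabolic with Denjoy--Wolff point $\infty$ if $f^n\to\infty$ uniformly on compact subsets of $\mathbb H$ and $f(z)/z\to 1$ as $z\to\infty$ non-tangentially in $\mathbb H$ (equivalently, the conjugate of $f$ to the unit disc is parabolic, with Denjoy--Wolff point the boundary point that corresponds to $\infty$). Let $\rho(z,w)=\left|\frac{z-w}{z-\overline w}\right|$ be the pseudo-hyperbolic distance on $\mathbb H$. The map $f$ has zero hyperbolic step if there is $z\in\mathbb H$ with $\rho(f^{n+1}(z),f^n(z))\to 0$ as $n\to\infty$, and positive hyperbolic step otherwise. **Theorem.** Let $f\colon\mathbb H\to\mathbb H$ be parabolic with Denjoy--Wolff point $\infty$, and let $\beta\in\mathbb R$ and a finite positive Borel measure $\mu$ on $\mathbb R$ be such that $$f(z)=z+\beta+\int_{\mathbb R}\frac{1+tz}{t-z}\,d\mu(t),\qquad z\in\mathbb H.$$ Suppose that $\int_{\mathbb R}|t|\,d\mu(t)<+\infty$.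 (a) If $\beta=\int_{\mathbb R}t\,d\mu(t)$, then $f$ has zero hyperbolic step. (b) If $\beta>\int_{\mathbb R}t\,d\mu(t)$, then $f$ has positive hyperbolic step if and only if $\int_{(0,+\infty)}t^2\,d\mu(t)<+\infty$. (c) If $\beta<\int_{\mathbb R}t\,d\mu(t)$, then $f$ has positive hyperbolic step if and only if $\int_{(-\infty,0)}t^2\,d\mu(t)<+\infty$. Furthermore, for every $z\in\mathbb H$, $f$ has zero hyperbolic step if and only if $\operatorname{Im} f^n(z)\to+\infty$ as $n\to\infty$. -/

import Mathlib

open Filter Topology MeasureTheory UpperHalfPlane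
open scoped Manifold ComplexConjugate

/-- The pseudo-hyperbolic distance of the upper half-plane, `|z - w| / |z - conj w|`. It is the
pseudo-hyperbolic distance of the unit disc transported by the Cayley transform. -/
noncomputable def pseudoHyperbolicDist (z w : ℍ) : ℝ :=
  ‖(z : ℂ) - (w : ℂ)‖ / ‖(z : ℂ) - conj (w : ℂ)‖

/-- `q` has angular (non-tangential) limit `l` at infinity: for each `M`, `q z` tends to `l` when
`|z| → ∞` with `z` in the Stolz angle `|Re z| ≤ M * Im z`. -/
def HasAngularLimitAtInfty (q : ℍ → ℂ) (l : ℂ) : Prop :=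
  ∀ M : ℝ, Tendsto q
    (comap (fun z : ℍ => ‖(z : ℂ)‖) atTop ⊓ 𝓟 {z : ℍ | |z.re| ≤ M * z.im}) (𝓝 l)

/-- The iterates of `f` tend to the boundary point infinity, uniformly on compact sets. -/
def HasDenjoyWolffPointInfty (f : ℍ → ℍ) : Prop :=
  ∀ K : Set ℍ, IsCompact K → ∀ R : ℝ, ∀ᶠ n in atTop, ∀ z ∈ K, R ≤ ‖((f^[n] z : ℍ) : ℂ)‖

/-- `f` is a parabolic holomorphic self-map of the upper half-plane whose Denjoy-Wolff point is
infinity. If `g` is the conjugate of `f` by the Cayley transform `z ↦ (z - i) / (z + i)`, which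
sends infinity to `1`, then `(g w - 1) / (w - 1) = (z + i) / (f z + i)`, so the angular derivative
of `g` at its Denjoy-Wolff point `1` equals `1` exactly when `f z / z` has angular limit `1`
at infinity. -/
structure IsParabolicAtInfty (f : ℍ → ℍ) : Prop where
  holomorphic : MDifferentiable 𝓘(ℂ) 𝓘(ℂ) f
  denjoyWolff : HasDenjoyWolffPointInfty f
  multiplier : HasAngularLimitAtInfty (fun z => (f z : ℂ) / (z : ℂ)) 1

/-- Zero hyperbolic step: some orbit has consecutive distances tending to zero. -/
def HasZeroHyperbolicStep (f : ℍ → ℍ) : Prop :=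
  ∃ z : ℍ, Tendsto (fun n : ℕ => pseudoHyperbolicDist (f^[n + 1] z) (f^[n] z)) atTop (𝓝 0)

/-- Positive hyperbolic step: not of zero hyperbolic step. -/
def HasPositiveHyperbolicStep (f : ℍ → ℍ) : Prop :=
  ¬ HasZeroHyperbolicStep f

/-! Put `ν = (1 + t²) μ` and `b = β - ∫ t dμ`. Then `f z = z + b + ∫ dν(t) / (t - z)`, where `ν` may
be infinite but integrates `1 / (1 + |t|)`, and the moment conditions say that `ν` is finite on a
half-line. Write `H`, `K`, `E` for `kernelNormSq`, `cauchyKernel`, `kernelDefect`. Everything rests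
on `Im f z = Im z (1 + H z)`, on `f z - f w = (z - w)(1 + K z w)`, and on a Schwarz-Pick inequality
whose remainder is `E`.

Zero step is equivalent to unbounded height (`tendsto_step_zero_iff`). If the heights are bounded,
`∑ H` converges along the orbit, so the displacements `f u - u` cannot shrink to zero and neither
can the step. If the step stays above `s > 0`, the Schwarz-Pick remainders tend to zero; comparison
with orbits started at `iR`, where the step is tiny, gives `H → 0` along the orbit, and a comparison
of displacements as `R → ∞` gives `s (Im z)² ≤ 8 b²` (`step_mul_im_sq_le`). Applied to every iterate
this bounds the heights; for `b = 0` it is absurd, which is (a).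

For `b > 0`, an orbit of bounded height must run off to the right with bounded gaps, and `∑ H < ∞`
then forces finite mass on `(0, ∞)` (`measure_Ioi_lt_top_of_im_le`). Conversely, finite mass there
makes a high orbit drift right by at least `b / 2` per step, so `∑ H` is bounded by an arctangent
integral and the height stays bounded (`exists_im_le_of_measure_Ioi_lt_top`). The case `b < 0`
follows by the reflection `z ↦ -conj z`. -/

/-- The Cauchy transform of a measure on the real line. -/
noncomputable def cauchyTransform (ν : Measure ℝ) (z : ℂ) : ℂ := ∫ t : ℝ, ((t : ℂ) - z)⁻¹ ∂ν

/-- The divided difference of the Cauchy transform. -/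
noncomputable def cauchyKernel (ν : Measure ℝ) (z w : ℂ) : ℂ :=
  ∫ t : ℝ, ((t : ℂ) - z)⁻¹ * ((t : ℂ) - w)⁻¹ ∂ν

/-- The squared `L²` norm of `t ↦ (t - z)⁻¹`. -/
noncomputable def kernelNormSq (ν : Measure ℝ) (z : ℂ) : ℝ := ∫ t : ℝ, ‖((t : ℂ) - z)⁻¹‖ ^ 2 ∂ν

/-- The squared `L²` norm of `t ↦ (t - z)⁻¹ (t - w)⁻¹`. -/
noncomputable def kernelDefect (ν : Measure ℝ) (z w : ℂ) : ℝ :=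
  ∫ t : ℝ, ‖((t : ℂ) - z)⁻¹‖ ^ 2 * ‖((t : ℂ) - w)⁻¹‖ ^ 2 ∂ν

/-- The self-map of the upper half-plane with Nevanlinna data `b`, `ν`. -/
noncomputable def pickMap (ν : Measure ℝ) (b : ℝ) (z : ℂ) : ℂ := z + b + cauchyTransform ν z

/-- A monotone function of the hyperbolic distance: it equals `4 sinh² (d / 2)`. -/
noncomputable def hypRatio (z w : ℂ) : ℝ := ‖z - w‖ ^ 2 / (z.im * w.im)

/-! ### Kernels -/

lemma ofReal_sub_ne_zero {z : ℂ} (hz : 0 < z.im) (t : ℝ) : (t : ℂ) - z ≠ 0 := by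
  intro h
  have := congrArg Complex.im h
  simp at this
  exact hz.ne' this

lemma im_le_norm_ofReal_sub (z : ℂ) (t : ℝ) : z.im ≤ ‖(t : ℂ) - z‖ := by
  have := Complex.abs_im_le_norm ((t : ℂ) - z)
  simp at this
  exact (le_abs_self _).trans this

lemma norm_ofReal_sub_pos {z : ℂ} (hz : 0 < z.im) (t : ℝ) : 0 < ‖(t : ℂ) - z‖ :=
  norm_pos_iff.2 (ofReal_sub_ne_zero hz t)

lemma norm_ofReal_sub_sq (z : ℂ) (t : ℝ) : ‖(t : ℂ) - z‖ ^ 2 = (t - z.re) ^ 2 + z.im ^ 2 := by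
  rw [Complex.sq_norm, Complex.normSq_apply]
  simp
  ring

lemma norm_kernel_le {z : ℂ} (hz : 0 < z.im) (t : ℝ) : ‖((t : ℂ) - z)⁻¹‖ ≤ z.im⁻¹ := by
  rw [norm_inv]
  exact inv_anti₀ hz (im_le_norm_ofReal_sub z t)

lemma norm_kernel_le_weight {z : ℂ} (hz : 0 < z.im) (t : ℝ) :
    ‖((t : ℂ) - z)⁻¹‖ ≤ ((1 + ‖z‖) / z.im + 1) * (1 + |t|)⁻¹ := by
  have h1 := im_le_norm_ofReal_sub z t
  have h2 : |t| ≤ ‖(t : ℂ) - z‖ + ‖z‖ := by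
    have := norm_add_le ((t : ℂ) - z) z
    simpa using this
  have h3 : 0 < ‖(t : ℂ) - z‖ := norm_ofReal_sub_pos hz t
  have h4 : 1 + ‖z‖ ≤ (1 + ‖z‖) / z.im * ‖(t : ℂ) - z‖ := by
    rw [div_mul_eq_mul_div, le_div_iff₀ hz]
    gcongr
  rw [norm_inv, ← div_eq_mul_inv, le_div_iff₀ (by positivity), inv_mul_le_iff₀ h3]
  nlinarith

lemma measurable_kernel (z : ℂ) : Measurable fun t : ℝ => ((t : ℂ) - z)⁻¹ := by fun_prop

section Kernels

variable {ν : Measure ℝ}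

lemma integrable_kernel (hν : Integrable (fun t : ℝ => (1 + |t|)⁻¹) ν) {z : ℂ} (hz : 0 < z.im) :
    Integrable (fun t : ℝ => ((t : ℂ) - z)⁻¹) ν :=
  (hν.const_mul ((1 + ‖z‖) / z.im + 1)).mono' (measurable_kernel z).aestronglyMeasurable
    (Eventually.of_forall fun t => norm_kernel_le_weight hz t)

lemma integrable_kernel_mul (hν : Integrable (fun t : ℝ => (1 + |t|)⁻¹) ν) {z w : ℂ}
    (hz : 0 < z.im) (hw : 0 < w.im) :
    Integrable (fun t : ℝ => ((t : ℂ) - z)⁻¹ * ((t : ℂ) - w)⁻¹) ν :=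
  (integrable_kernel hν hz).mul_bdd (c := w.im⁻¹) (measurable_kernel w).aestronglyMeasurable
    (Eventually.of_forall fun t => norm_kernel_le hw t)

lemma integrable_norm_kernel_mul (hν : Integrable (fun t : ℝ => (1 + |t|)⁻¹) ν) {z w : ℂ}
    (hz : 0 < z.im) (hw : 0 < w.im) :
    Integrable (fun t : ℝ => ‖((t : ℂ) - z)⁻¹‖ * ‖((t : ℂ) - w)⁻¹‖) ν := by
  simpa only [norm_mul] using (integrable_kernel_mul hν hz hw).norm

lemma integrable_norm_kernel_sq (hν : Integrable (fun t : ℝ => (1 + |t|)⁻¹) ν) {z : ℂ}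
    (hz : 0 < z.im) : Integrable (fun t : ℝ => ‖((t : ℂ) - z)⁻¹‖ ^ 2) ν := by
  simpa only [sq] using integrable_norm_kernel_mul hν hz hz

lemma integrable_kernelDefect (hν : Integrable (fun t : ℝ => (1 + |t|)⁻¹) ν) {z w : ℂ}
    (hz : 0 < z.im) (hw : 0 < w.im) :
    Integrable (fun t : ℝ => ‖((t : ℂ) - z)⁻¹‖ ^ 2 * ‖((t : ℂ) - w)⁻¹‖ ^ 2) ν :=
  (integrable_norm_kernel_sq hν hz).mul_bdd (c := w.im⁻¹ ^ 2)
    ((measurable_kernel w).norm.pow_const 2).aestronglyMeasurable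
    (Eventually.of_forall fun t => by
      rw [Real.norm_of_nonneg (by positivity)]
      gcongr
      exact norm_kernel_le hw t)

lemma kernelNormSq_nonneg (z : ℂ) : 0 ≤ kernelNormSq ν z := integral_nonneg fun _ => by positivity

lemma kernelDefect_nonneg (z w : ℂ) : 0 ≤ kernelDefect ν z w :=
  integral_nonneg fun _ => by positivity

lemma im_kernel {z : ℂ} (t : ℝ) : (((t : ℂ) - z)⁻¹).im = z.im * ‖((t : ℂ) - z)⁻¹‖ ^ 2 := by
  rw [Complex.inv_im, norm_inv, inv_pow, Complex.sq_norm]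
  simp [div_eq_mul_inv]

lemma re_kernel {z : ℂ} (t : ℝ) :
    (((t : ℂ) - z)⁻¹).re = (t - z.re) * ‖((t : ℂ) - z)⁻¹‖ ^ 2 := by
  rw [Complex.inv_re, norm_inv, inv_pow, Complex.sq_norm]
  simp [div_eq_mul_inv]

lemma im_cauchyTransform (hν : Integrable (fun t : ℝ => (1 + |t|)⁻¹) ν) {z : ℂ}
    (hz : 0 < z.im) : (cauchyTransform ν z).im = z.im * kernelNormSq ν z := by
  have h := (integral_im (integrable_kernel hν hz)).symm
  simp only [RCLike.im_to_complex, im_kernel] at h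
  rw [cauchyTransform, h, integral_const_mul, kernelNormSq]

lemma im_pickMap (hν : Integrable (fun t : ℝ => (1 + |t|)⁻¹) ν) (b : ℝ) {z : ℂ}
    (hz : 0 < z.im) : (pickMap ν b z).im = z.im * (1 + kernelNormSq ν z) := by
  simp [pickMap, im_cauchyTransform hν hz]
  ring

lemma im_pickMap_pos (hν : Integrable (fun t : ℝ => (1 + |t|)⁻¹) ν) (b : ℝ) {z : ℂ}
    (hz : 0 < z.im) : 0 < (pickMap ν b z).im := by
  rw [im_pickMap hν b hz]
  have := kernelNormSq_nonneg (ν := ν) z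
  positivity

lemma pickMap_sub_pickMap (hν : Integrable (fun t : ℝ => (1 + |t|)⁻¹) ν) (b : ℝ) {z w : ℂ}
    (hz : 0 < z.im) (hw : 0 < w.im) :
    pickMap ν b z - pickMap ν b w = (z - w) * (1 + cauchyKernel ν z w) := by
  have h : cauchyTransform ν z - cauchyTransform ν w = (z - w) * cauchyKernel ν z w := by
    rw [cauchyTransform, cauchyTransform, cauchyKernel,
      ← integral_sub (integrable_kernel hν hz) (integrable_kernel hν hw), ← integral_const_mul]
    congr 1 with t
    have h1 := ofReal_sub_ne_zero hz t
    have h2 := ofReal_sub_ne_zero hw t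
    field_simp
    ring
  rw [pickMap, pickMap, mul_add, ← h]
  ring

/-- Cauchy-Schwarz, from the discriminant of the nonnegative quadratic `r ↦ ∫ (r |t - w|⁻¹ - |t -
z|⁻¹)² dν`. -/
lemma norm_cauchyKernel_sq_le (hν : Integrable (fun t : ℝ => (1 + |t|)⁻¹) ν) {z w : ℂ}
    (hz : 0 < z.im) (hw : 0 < w.im) :
    ‖cauchyKernel ν z w‖ ^ 2 ≤ kernelNormSq ν z * kernelNormSq ν w := by
  set M := ∫ t : ℝ, ‖((t : ℂ) - z)⁻¹‖ * ‖((t : ℂ) - w)⁻¹‖ ∂ν with hM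
  have hK : ‖cauchyKernel ν z w‖ ≤ M := by
    refine (norm_integral_le_integral_norm _).trans_eq ?_
    simp only [norm_mul, hM]
  have hdisc : discrim (kernelNormSq ν w) (-2 * M) (kernelNormSq ν z) ≤ 0 := by
    refine discrim_le_zero fun r => ?_
    have key : kernelNormSq ν w * (r * r) + -2 * M * r + kernelNormSq ν z =
        ∫ t : ℝ, (‖((t : ℂ) - w)⁻¹‖ ^ 2 * (r * r)
          + (‖((t : ℂ) - z)⁻¹‖ * ‖((t : ℂ) - w)⁻¹‖) * (-2 * r)) + ‖((t : ℂ) - z)⁻¹‖ ^ 2 ∂ν := by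
      have h1 := (integrable_norm_kernel_sq hν hw).mul_const (r * r)
      have h2 := (integrable_norm_kernel_mul hν hz hw).mul_const (-2 * r)
      have h12 : Integrable (fun t : ℝ => ‖((t : ℂ) - w)⁻¹‖ ^ 2 * (r * r)
          + (‖((t : ℂ) - z)⁻¹‖ * ‖((t : ℂ) - w)⁻¹‖) * (-2 * r)) ν := h1.add h2
      rw [integral_add h12 (integrable_norm_kernel_sq hν hz), integral_add h1 h2,
        integral_mul_const, integral_mul_const, ← hM, kernelNormSq, kernelNormSq]
      ring
    rw [key]
    refine integral_nonneg fun t => ?_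
    dsimp only [Pi.zero_apply]
    nlinarith [sq_nonneg (‖((t : ℂ) - w)⁻¹‖ * r - ‖((t : ℂ) - z)⁻¹‖)]
  have h3 : ‖cauchyKernel ν z w‖ ^ 2 ≤ M ^ 2 := by gcongr
  rw [discrim] at hdisc
  nlinarith

lemma two_mul_norm_cauchyKernel_le (hν : Integrable (fun t : ℝ => (1 + |t|)⁻¹) ν) {z w : ℂ}
    (hz : 0 < z.im) (hw : 0 < w.im) :
    2 * ‖cauchyKernel ν z w‖ ≤ kernelNormSq ν z + kernelNormSq ν w := by
  have h1 := norm_cauchyKernel_sq_le hν hz hw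
  have h2 := kernelNormSq_nonneg (ν := ν) z
  have h3 := kernelNormSq_nonneg (ν := ν) w
  refine abs_le_of_sq_le_sq' ?_ (by positivity) |>.2
  nlinarith [sq_nonneg (kernelNormSq ν z - kernelNormSq ν w)]

/-- Squared modulus of `(t - z)⁻¹ - conj (t - w)⁻¹ = (z - conj w) / ((t - z)(t - conj w))`. -/
lemma norm_sub_conj_sq_mul_kernel {z w : ℂ} (hz : 0 < z.im) (hw : 0 < w.im) (t : ℝ) :
    ‖z - conj w‖ ^ 2 * (‖((t : ℂ) - z)⁻¹‖ ^ 2 * ‖((t : ℂ) - w)⁻¹‖ ^ 2) =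
      ‖((t : ℂ) - z)⁻¹‖ ^ 2 + ‖((t : ℂ) - w)⁻¹‖ ^ 2
        - 2 * (((t : ℂ) - z)⁻¹ * ((t : ℂ) - w)⁻¹).re := by
  have h1 := ofReal_sub_ne_zero hz t
  have h2 := ofReal_sub_ne_zero hw t
  have h3 : (t : ℂ) - conj w ≠ 0 := by
    rw [← Complex.conj_ofReal, ← map_sub]
    exact (map_ne_zero _).2 h2
  have h4 : ‖(t : ℂ) - w‖ = ‖(t : ℂ) - conj w‖ := by
    rw [← Complex.norm_conj, map_sub, Complex.conj_ofReal]
  have h5 : ‖z - conj w‖ ^ 2 * (‖((t : ℂ) - z)⁻¹‖ ^ 2 * ‖((t : ℂ) - w)⁻¹‖ ^ 2) =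
      ‖((t : ℂ) - z)⁻¹ - conj ((t : ℂ) - w)⁻¹‖ ^ 2 := by
    rw [norm_inv ((t : ℂ) - w), h4, ← norm_inv, ← mul_pow, ← mul_pow, ← norm_mul, ← norm_mul]
    congr 2
    rw [map_inv₀, map_sub, Complex.conj_ofReal]
    field_simp
    ring
  rw [h5, Complex.sq_norm, Complex.normSq_sub, Complex.conj_conj, Complex.normSq_conj,
    Complex.sq_norm, Complex.sq_norm]

lemma norm_sub_conj_sq_mul_kernelDefect (hν : Integrable (fun t : ℝ => (1 + |t|)⁻¹) ν) {z w : ℂ}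
    (hz : 0 < z.im) (hw : 0 < w.im) :
    ‖z - conj w‖ ^ 2 * kernelDefect ν z w =
      kernelNormSq ν z + kernelNormSq ν w - 2 * (cauchyKernel ν z w).re := by
  have hK : (cauchyKernel ν z w).re = ∫ t : ℝ, (((t : ℂ) - z)⁻¹ * ((t : ℂ) - w)⁻¹).re ∂ν := by
    exact (integral_re (integrable_kernel_mul hν hz hw)).symm
  have h1 := integrable_norm_kernel_sq hν hz
  have h2 := integrable_norm_kernel_sq hν hw
  have h3 : Integrable (fun t : ℝ => (((t : ℂ) - z)⁻¹ * ((t : ℂ) - w)⁻¹).re) ν := by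
    exact (integrable_kernel_mul hν hz hw).re
  rw [kernelDefect, ← integral_const_mul]
  simp_rw [norm_sub_conj_sq_mul_kernel hz hw]
  have h12 : Integrable (fun t : ℝ => ‖((t : ℂ) - z)⁻¹‖ ^ 2 + ‖((t : ℂ) - w)⁻¹‖ ^ 2) ν := h1.add h2
  rw [integral_sub h12 (h3.const_mul 2), integral_add h1 h2, integral_const_mul, hK,
    kernelNormSq, kernelNormSq]

/-- A Schwarz-Pick inequality with remainder. -/
lemma norm_one_add_cauchyKernel_sq_add_le (hν : Integrable (fun t : ℝ => (1 + |t|)⁻¹) ν)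
    {z w : ℂ} (hz : 0 < z.im) (hw : 0 < w.im) :
    ‖1 + cauchyKernel ν z w‖ ^ 2 + ‖z - conj w‖ ^ 2 * kernelDefect ν z w ≤
      (1 + kernelNormSq ν z) * (1 + kernelNormSq ν w) := by
  -- The term `2 Re K` of `|1 + K|²` cancels against the defect identity, leaving `|K|² ≤ H z * H
  -- w`.
  have h := norm_cauchyKernel_sq_le hν hz hw
  rw [norm_sub_conj_sq_mul_kernelDefect hν hz hw]
  rw [Complex.sq_norm, Complex.normSq_apply] at h ⊢
  simp only [Complex.add_re, Complex.add_im, Complex.one_re, Complex.one_im]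
  nlinarith

end Kernels

/-! ### The hyperbolic ratio -/

lemma hypRatio_nonneg {z w : ℂ} (hz : 0 < z.im) (hw : 0 < w.im) : 0 ≤ hypRatio z w := by
  unfold hypRatio; positivity

lemma hypRatio_comm (z w : ℂ) : hypRatio z w = hypRatio w z := by
  rw [hypRatio, hypRatio, norm_sub_rev, mul_comm z.im]

lemma norm_sub_sq_eq_hypRatio_mul {z w : ℂ} (hz : 0 < z.im) (hw : 0 < w.im) :
    ‖z - w‖ ^ 2 = hypRatio z w * (z.im * w.im) := by
  rw [hypRatio, div_mul_cancel₀ _ (by positivity)]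

lemma im_sub_im_sq_le {z w : ℂ} (hz : 0 < z.im) (hw : 0 < w.im) :
    (z.im - w.im) ^ 2 ≤ hypRatio z w * (z.im * w.im) := by
  rw [← norm_sub_sq_eq_hypRatio_mul hz hw, Complex.sq_norm, Complex.normSq_apply]
  simp only [Complex.sub_im, Complex.sub_re]
  nlinarith [sq_nonneg (z.re - w.re)]

lemma im_le_of_hypRatio_le {z w : ℂ} {D : ℝ} (hz : 0 < z.im) (hw : 0 < w.im)
    (hD : hypRatio z w ≤ D) : z.im ≤ (D + 2) * w.im := by
  have h := im_sub_im_sq_le hz hw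
  have h1 : hypRatio z w * (z.im * w.im) ≤ D * (z.im * w.im) := by gcongr
  have h2 : z.im * z.im ≤ z.im * ((D + 2) * w.im) := by nlinarith [sq_nonneg w.im]
  exact le_of_mul_le_mul_left h2 hz

lemma norm_sub_le_of_hypRatio_le {z w : ℂ} {D : ℝ} (hz : 0 < z.im) (hw : 0 < w.im)
    (hD : hypRatio z w ≤ D) : ‖z - w‖ ≤ (D + 1) * w.im := by
  have h0 := (hypRatio_nonneg hz hw).trans hD
  have h1 := im_le_of_hypRatio_le hz hw hD
  refine abs_le_of_sq_le_sq' ?_ (by positivity) |>.2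
  rw [norm_sub_sq_eq_hypRatio_mul hz hw]
  calc hypRatio z w * (z.im * w.im) ≤ D * ((D + 2) * w.im * w.im) := by gcongr
    _ ≤ ((D + 1) * w.im) ^ 2 := by nlinarith [sq_nonneg w.im]

/-- A Harnack comparison: since `|z - w| ≤ (D + 1) Im w ≤ (D + 1) |t - w|`, bounded hyperbolic
distance makes the kernels comparable uniformly in `t`. -/
lemma norm_ofReal_sub_le_of_hypRatio_le {z w : ℂ} {D : ℝ} (hz : 0 < z.im) (hw : 0 < w.im)
    (hD : hypRatio z w ≤ D) (t : ℝ) : ‖(t : ℂ) - z‖ ≤ (D + 2) * ‖(t : ℂ) - w‖ := by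
  have h0 := (hypRatio_nonneg hz hw).trans hD
  have h1 := norm_sub_le_of_hypRatio_le hz hw hD
  have h2 := im_le_norm_ofReal_sub w t
  have h3 : ‖(t : ℂ) - z‖ ≤ ‖(t : ℂ) - w‖ + ‖z - w‖ := by
    have := norm_sub_le ((t : ℂ) - w) (z - w)
    simpa using this
  nlinarith

lemma norm_kernel_le_of_hypRatio_le {z w : ℂ} {D : ℝ} (hz : 0 < z.im) (hw : 0 < w.im)
    (hD : hypRatio z w ≤ D) (t : ℝ) :
    ‖((t : ℂ) - w)⁻¹‖ ≤ (D + 2) * ‖((t : ℂ) - z)⁻¹‖ := by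
  have h := norm_ofReal_sub_le_of_hypRatio_le hz hw hD t
  have h1 := norm_ofReal_sub_pos hz t
  have h2 := norm_ofReal_sub_pos hw t
  rw [norm_inv, norm_inv, ← div_eq_mul_inv, le_div_iff₀ h1, inv_mul_le_iff₀ h2]
  linarith

lemma hypRatio_pickMap {ν : Measure ℝ} (hν : Integrable (fun t : ℝ => (1 + |t|)⁻¹) ν) (b : ℝ)
    {z w : ℂ} (hz : 0 < z.im) (hw : 0 < w.im) :
    hypRatio (pickMap ν b z) (pickMap ν b w) * ((1 + kernelNormSq ν z) * (1 + kernelNormSq ν w)) =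
      hypRatio z w * ‖1 + cauchyKernel ν z w‖ ^ 2 := by
  have h1 := kernelNormSq_nonneg (ν := ν) z
  have h2 := kernelNormSq_nonneg (ν := ν) w
  rw [hypRatio, hypRatio, pickMap_sub_pickMap hν b hz hw, im_pickMap hν b hz, im_pickMap hν b hw,
    norm_mul]
  field_simp

/-- The Schwarz-Pick inequality with remainder, for `hypRatio`. -/
lemma hypRatio_pickMap_add_le {ν : Measure ℝ} (hν : Integrable (fun t : ℝ => (1 + |t|)⁻¹) ν)
    (b : ℝ) {z w : ℂ} (hz : 0 < z.im) (hw : 0 < w.im) :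
    hypRatio z w * (‖z - conj w‖ ^ 2 * kernelDefect ν z w) ≤
      (hypRatio z w - hypRatio (pickMap ν b z) (pickMap ν b w)) *
        ((1 + kernelNormSq ν z) * (1 + kernelNormSq ν w)) := by
  have h1 := norm_one_add_cauchyKernel_sq_add_le hν hz hw
  have h2 := hypRatio_pickMap hν b hz hw
  have h3 := mul_le_mul_of_nonneg_left h1 (hypRatio_nonneg hz hw)
  linarith

lemma hypRatio_pickMap_le {ν : Measure ℝ} (hν : Integrable (fun t : ℝ => (1 + |t|)⁻¹) ν)
    (b : ℝ) {z w : ℂ} (hz : 0 < z.im) (hw : 0 < w.im) :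
    hypRatio (pickMap ν b z) (pickMap ν b w) ≤ hypRatio z w := by
  have h1 := hypRatio_pickMap_add_le hν b hz hw
  have h2 := kernelNormSq_nonneg (ν := ν) z
  have h3 := kernelNormSq_nonneg (ν := ν) w
  have h4 := hypRatio_nonneg hz hw
  have h5 := kernelDefect_nonneg (ν := ν) z w
  have h6 : 0 ≤ (hypRatio z w - hypRatio (pickMap ν b z) (pickMap ν b w)) *
      ((1 + kernelNormSq ν z) * (1 + kernelNormSq ν w)) := h1.trans' (by positivity)
  linarith [nonneg_of_mul_nonneg_left h6 (by positivity)]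

/-! ### Iterates and the hyperbolic step -/

section Iterates

variable {ν : Measure ℝ}

lemma kernelNormSq_le_of_hypRatio_le (hν : Integrable (fun t : ℝ => (1 + |t|)⁻¹) ν) {z w : ℂ}
    {D : ℝ} (hz : 0 < z.im) (hw : 0 < w.im) (hD : hypRatio z w ≤ D) :
    kernelNormSq ν w ≤ (D + 2) ^ 2 * kernelNormSq ν z := by
  rw [kernelNormSq, kernelNormSq, ← integral_const_mul]
  refine integral_mono (integrable_norm_kernel_sq hν hw)
    ((integrable_norm_kernel_sq hν hz).const_mul _) fun t => ?_
  dsimp only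
  rw [← mul_pow]
  gcongr
  exact norm_kernel_le_of_hypRatio_le hz hw hD t

lemma kernelDefect_le_of_hypRatio_le (hν : Integrable (fun t : ℝ => (1 + |t|)⁻¹) ν) {z w : ℂ}
    {D : ℝ} (hz : 0 < z.im) (hw : 0 < w.im) (hD : hypRatio z w ≤ D) :
    kernelDefect ν w w ≤ (D + 2) ^ 2 * kernelDefect ν z w := by
  rw [kernelDefect, kernelDefect, ← integral_const_mul]
  refine integral_mono (integrable_kernelDefect hν hw hw)
    ((integrable_kernelDefect hν hz hw).const_mul _) fun t => ?_
  dsimp only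
  rw [← mul_assoc, ← mul_pow (D + 2)]
  exact mul_le_mul_of_nonneg_right
    (pow_le_pow_left₀ (norm_nonneg _) (norm_kernel_le_of_hypRatio_le hz hw hD t) 2) (by positivity)

/-- If `|t - z| ≥ (D + 1) Im z ≥ |w - z|`, then `|t - w| ≤ 2 |t - z|`, which gives the first term.
For the other `t`, `1 ≤ (D + 1)² (Im z)² |t - z|⁻²`, so the second power of the kernel is absorbed
by the fourth. -/
lemma kernelNormSq_le_add_kernelDefect (hν : Integrable (fun t : ℝ => (1 + |t|)⁻¹) ν) {z w : ℂ}
    {D : ℝ} (hz : 0 < z.im) (hw : 0 < w.im) (hD : hypRatio w z ≤ D) :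
    kernelNormSq ν z ≤
      4 * kernelNormSq ν w + (D + 1) ^ 2 * (z.im ^ 2 * kernelDefect ν z z) := by
  have h0 := (hypRatio_nonneg hw hz).trans hD
  have h1 := (integrable_norm_kernel_sq hν hw).const_mul 4
  have h2 := ((integrable_kernelDefect hν hz hz).const_mul (z.im ^ 2)).const_mul ((D + 1) ^ 2)
  rw [kernelNormSq, kernelNormSq, kernelDefect, ← integral_const_mul, ← integral_const_mul,
    ← integral_const_mul, ← integral_add h1 h2]
  refine integral_mono (integrable_norm_kernel_sq hν hz) (h1.add h2) fun t => ?_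
  dsimp only [Pi.add_apply]
  have ha := norm_ofReal_sub_pos hz t
  have hb := norm_ofReal_sub_pos hw t
  have hab : ‖(t : ℂ) - w‖ ≤ ‖(t : ℂ) - z‖ + ‖w - z‖ := by
    have := norm_sub_le ((t : ℂ) - z) (w - z)
    simpa using this
  have hd := norm_sub_le_of_hypRatio_le hw hz hD
  rcases le_total ((D + 1) * z.im) ‖(t : ℂ) - z‖ with h | h
  · have h3 : ‖((t : ℂ) - z)⁻¹‖ ≤ 2 * ‖((t : ℂ) - w)⁻¹‖ := by
      rw [norm_inv, norm_inv, ← div_eq_mul_inv, le_div_iff₀ hb, inv_mul_le_iff₀ ha]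
      linarith
    have h4 : ‖((t : ℂ) - z)⁻¹‖ ^ 2 ≤ (2 * ‖((t : ℂ) - w)⁻¹‖) ^ 2 := by gcongr
    have h5 : 0 ≤ (D + 1) ^ 2 * (z.im ^ 2 * (‖((t : ℂ) - z)⁻¹‖ ^ 2 * ‖((t : ℂ) - z)⁻¹‖ ^ 2)) := by
      positivity
    linarith
  · have h3 : 1 ≤ (D + 1) * z.im * ‖((t : ℂ) - z)⁻¹‖ := by
      rw [norm_inv, ← div_eq_mul_inv, le_div_iff₀ ha]
      linarith
    have h4 : 1 ≤ ((D + 1) * z.im * ‖((t : ℂ) - z)⁻¹‖) ^ 2 := one_le_pow₀ h3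
    nlinarith [mul_le_mul_of_nonneg_left h4 (sq_nonneg ‖((t : ℂ) - z)⁻¹‖),
      sq_nonneg ‖((t : ℂ) - w)⁻¹‖]

lemma one_add_kernelNormSq_le (hν : Integrable (fun t : ℝ => (1 + |t|)⁻¹) ν) (b : ℝ) {z : ℂ}
    {D : ℝ} (hz : 0 < z.im) (hD : hypRatio (pickMap ν b z) z ≤ D) :
    1 + kernelNormSq ν z ≤ D + 2 := by
  have h := im_le_of_hypRatio_le (im_pickMap_pos hν b hz) hz hD
  rw [im_pickMap hν b hz, mul_comm] at h
  exact le_of_mul_le_mul_right h hz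

lemma kernelNormSq_sq_le (hν : Integrable (fun t : ℝ => (1 + |t|)⁻¹) ν) (b : ℝ) {z : ℂ}
    {D : ℝ} (hz : 0 < z.im) (hD : hypRatio (pickMap ν b z) z ≤ D) :
    kernelNormSq ν z ^ 2 ≤ D * (1 + kernelNormSq ν z) := by
  have h := im_sub_im_sq_le (im_pickMap_pos hν b hz) hz
  have hH := kernelNormSq_nonneg (ν := ν) z
  rw [im_pickMap hν b hz] at h
  have h1 : z.im ^ 2 * kernelNormSq ν z ^ 2 ≤
      z.im ^ 2 * (hypRatio (pickMap ν b z) z * (1 + kernelNormSq ν z)) := by nlinarith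
  refine (le_of_mul_le_mul_left h1 (by positivity)).trans ?_
  gcongr

/-- A step moves the height by `Im z * H z`, so a small step forces small `H`. If `H > ε`, then `ε²
/ 4 * (1 + H) < H²`, against `kernelNormSq_sq_le`. -/
lemma kernelNormSq_le_of_step_le (hν : Integrable (fun t : ℝ => (1 + |t|)⁻¹) ν) (b : ℝ) {z : ℂ}
    {ε : ℝ} (hε : 0 < ε) (hε1 : ε ≤ 1) (hz : 0 < z.im)
    (hD : hypRatio (pickMap ν b z) z ≤ ε ^ 2 / 4) : kernelNormSq ν z ≤ ε := by
  have h := kernelNormSq_sq_le hν b hz hD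
  by_contra! hlt
  have h1 : ε ^ 2 < kernelNormSq ν z ^ 2 := by gcongr
  have h2 : ε ^ 2 * kernelNormSq ν z ≤ kernelNormSq ν z ^ 2 := by
    rw [sq (kernelNormSq ν z)]
    exact mul_le_mul_of_nonneg_right (by nlinarith) (by linarith)
  nlinarith

lemma im_iterate_pickMap_pos (hν : Integrable (fun t : ℝ => (1 + |t|)⁻¹) ν) (b : ℝ) {z : ℂ}
    (hz : 0 < z.im) (n : ℕ) : 0 < ((pickMap ν b)^[n] z).im := by
  induction n with
  | zero => simpa using hz
  | succ n ih =>
    rw [Function.iterate_succ_apply']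
    exact im_pickMap_pos hν b ih

lemma antitone_hypRatio_iterate (hν : Integrable (fun t : ℝ => (1 + |t|)⁻¹) ν) (b : ℝ) {z w : ℂ}
    (hz : 0 < z.im) (hw : 0 < w.im) :
    Antitone fun n : ℕ => hypRatio ((pickMap ν b)^[n] z) ((pickMap ν b)^[n] w) := by
  refine antitone_nat_of_succ_le fun n => ?_
  rw [Function.iterate_succ_apply', Function.iterate_succ_apply']
  exact hypRatio_pickMap_le hν b (im_iterate_pickMap_pos hν b hz n)
    (im_iterate_pickMap_pos hν b hw n)

lemma hypRatio_iterate_le (hν : Integrable (fun t : ℝ => (1 + |t|)⁻¹) ν) (b : ℝ) {z w : ℂ}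
    (hz : 0 < z.im) (hw : 0 < w.im) (n : ℕ) :
    hypRatio ((pickMap ν b)^[n] z) ((pickMap ν b)^[n] w) ≤ hypRatio z w :=
  antitone_hypRatio_iterate hν b hz hw (Nat.zero_le n)

lemma antitone_step (hν : Integrable (fun t : ℝ => (1 + |t|)⁻¹) ν) (b : ℝ) {z : ℂ}
    (hz : 0 < z.im) :
    Antitone fun n : ℕ => hypRatio ((pickMap ν b)^[n + 1] z) ((pickMap ν b)^[n] z) := by
  simpa only [Function.iterate_succ_apply] using
    antitone_hypRatio_iterate hν b (im_pickMap_pos hν b hz) hz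

lemma step_le (hν : Integrable (fun t : ℝ => (1 + |t|)⁻¹) ν) (b : ℝ) {z : ℂ}
    (hz : 0 < z.im) (n : ℕ) :
    hypRatio (pickMap ν b ((pickMap ν b)^[n] z)) ((pickMap ν b)^[n] z) ≤
      hypRatio (pickMap ν b z) z := by
  simpa only [Function.iterate_succ_apply', Function.iterate_zero, id] using antitone_step hν b hz (Nat.zero_le n)

/-! ### Orbits whose step is bounded below -/

/-- The steps `D n` decrease to a limit, so `D n - D (n + 1) → 0`; the Schwarz-Pick remainder bounds
`s (Im u)² E(u, u)` by a constant times this difference. -/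
lemma tendsto_im_sq_mul_kernelDefect (hν : Integrable (fun t : ℝ => (1 + |t|)⁻¹) ν) (b : ℝ)
    {z : ℂ} {s : ℝ} (hz : 0 < z.im) (hs : 0 < s)
    (hstep : ∀ n : ℕ, s ≤ hypRatio ((pickMap ν b)^[n + 1] z) ((pickMap ν b)^[n] z)) :
    Tendsto (fun n : ℕ => ((pickMap ν b)^[n] z).im ^ 2 *
      kernelDefect ν ((pickMap ν b)^[n] z) ((pickMap ν b)^[n] z)) atTop (𝓝 0) := by
  set D : ℕ → ℝ := fun n => hypRatio ((pickMap ν b)^[n + 1] z) ((pickMap ν b)^[n] z) with hDdef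
  have hlim : Tendsto D atTop (𝓝 (⨅ n, D n)) :=
    tendsto_atTop_ciInf (antitone_step hν b hz) ⟨s, by rintro _ ⟨n, rfl⟩; exact hstep n⟩
  have hdiff : Tendsto (fun n => s⁻¹ * ((D n - D (n + 1)) * (D 0 + 2) ^ 4)) atTop (𝓝 0) := by
    have := ((hlim.sub (hlim.comp (tendsto_add_atTop_nat 1))).mul_const ((D 0 + 2) ^ 4)).const_mul
      s⁻¹
    simpa using this
  have hpos := im_iterate_pickMap_pos hν b hz
  refine squeeze_zero (fun n => mul_nonneg (sq_nonneg _) (kernelDefect_nonneg _ _)) (fun n => ?_)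
    hdiff
  have hD0 : 0 ≤ D 0 := hs.le.trans (hstep 0)
  set u := (pickMap ν b)^[n] z with hu
  set v := (pickMap ν b)^[n + 1] z with hv
  have hDn : hypRatio v u ≤ D 0 := antitone_step hν b hz (Nat.zero_le n)
  have hDn1 : hypRatio (pickMap ν b v) v ≤ D 0 := step_le hν b hz (n + 1)
  have hvu : v = pickMap ν b u := Function.iterate_succ_apply' _ _ _
  have h1 := hypRatio_pickMap_add_le hν b (hpos (n + 1)) (hpos n)
  have h2 : hypRatio (pickMap ν b v) (pickMap ν b u) = D (n + 1) := by
    simp only [hDdef, hv, hu, ← Function.iterate_succ_apply']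
  rw [← hu, ← hv, h2] at h1
  have h3 := one_add_kernelNormSq_le hν b (hpos n) (hvu ▸ hDn)
  have h4 := one_add_kernelNormSq_le hν b (hpos (n + 1)) hDn1
  have h5 : u.im ^ 2 ≤ ‖v - conj u‖ ^ 2 := by
    have h6 := Complex.abs_im_le_norm (v - conj u)
    have h7 := hpos n
    have h8 := hpos (n + 1)
    simp only [Complex.sub_im, Complex.conj_im, sub_neg_eq_add] at h6
    have h9 := (le_abs_self _).trans h6
    rw [← hu] at h7
    rw [← hv] at h8
    gcongr
    linarith
  have h6 := kernelDefect_le_of_hypRatio_le hν (hpos (n + 1)) (hpos n) hDn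
  rw [← hu, ← hv] at h6
  have h7 := kernelDefect_nonneg (ν := ν) v u
  have h8 : 0 ≤ D n - D (n + 1) := sub_nonneg.2 (antitone_step hν b hz (Nat.le_succ n))
  have h9 := kernelNormSq_nonneg (ν := ν) u
  have h10 := kernelNormSq_nonneg (ν := ν) v
  rw [le_inv_mul_iff₀ hs]
  calc s * (u.im ^ 2 * kernelDefect ν u u)
      ≤ D n * (‖v - conj u‖ ^ 2 * ((D 0 + 2) ^ 2 * kernelDefect ν v u)) := by
        have := kernelDefect_nonneg (ν := ν) u u
        gcongr
        exact hs.le.trans (hstep n)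
        exact hstep n
    _ = D n * (‖v - conj u‖ ^ 2 * kernelDefect ν v u) * (D 0 + 2) ^ 2 := by ring
    _ ≤ (D n - D (n + 1)) * ((1 + kernelNormSq ν v) * (1 + kernelNormSq ν u)) * (D 0 + 2) ^ 2 := by
        gcongr
    _ ≤ (D n - D (n + 1)) * ((D 0 + 2) * (D 0 + 2)) * (D 0 + 2) ^ 2 := by gcongr
    _ = (D n - D (n + 1)) * (D 0 + 2) ^ 4 := by ring

/-- The Cauchy transform vanishes at infinity along the imaginary axis. -/
lemma tendsto_cauchyTransform_mul_I (hν : Integrable (fun t : ℝ => (1 + |t|)⁻¹) ν) :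
    Tendsto (fun R : ℝ => cauchyTransform ν (R * Complex.I)) atTop (𝓝 0) := by
  have h : Tendsto (fun R : ℝ => cauchyTransform ν (R * Complex.I)) atTop
      (𝓝 (∫ _ : ℝ, (0 : ℂ) ∂ν)) := by
    refine tendsto_integral_filter_of_dominated_convergence (fun t => 2 * (1 + |t|)⁻¹)
      (Eventually.of_forall fun R => (measurable_kernel _).aestronglyMeasurable) ?_
      (hν.const_mul 2) (Eventually.of_forall fun t => ?_)
    · filter_upwards [eventually_ge_atTop 1] with R hR
      refine Eventually.of_forall fun t => ?_
      have h1 : R ≤ ‖(t : ℂ) - R * Complex.I‖ := by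
        simpa using im_le_norm_ofReal_sub (R * Complex.I) t
      have h2 : |t| ≤ ‖(t : ℂ) - R * Complex.I‖ := by
        simpa using Complex.abs_re_le_norm ((t : ℂ) - R * Complex.I)
      rw [norm_inv, ← div_eq_mul_inv, le_div_iff₀ (by positivity), inv_mul_le_iff₀ (by linarith)]
      linarith
    · refine squeeze_zero_norm' ?_ tendsto_inv_atTop_zero
      filter_upwards [eventually_gt_atTop 0] with R hR
      simpa using norm_kernel_le (z := R * Complex.I) (by simpa using hR) t
  simpa using h

lemma step_le_norm_sq_div (hν : Integrable (fun t : ℝ => (1 + |t|)⁻¹) ν) (b : ℝ) {z : ℂ}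
    (hz : 0 < z.im) :
    hypRatio (pickMap ν b z) z ≤ (‖b + cauchyTransform ν z‖ / z.im) ^ 2 := by
  have hH := kernelNormSq_nonneg (ν := ν) z
  have h : pickMap ν b z - z = b + cauchyTransform ν z := by rw [pickMap]; ring
  rw [hypRatio, h, im_pickMap hν b hz, div_pow]
  gcongr
  nlinarith [mul_pos hz hz]

lemma tendsto_kernelNormSq_iterate (hν : Integrable (fun t : ℝ => (1 + |t|)⁻¹) ν) (b : ℝ)
    {z : ℂ} {s : ℝ} (hz : 0 < z.im) (hs : 0 < s)
    (hstep : ∀ n : ℕ, s ≤ hypRatio ((pickMap ν b)^[n + 1] z) ((pickMap ν b)^[n] z)) :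
    Tendsto (fun n : ℕ => kernelNormSq ν ((pickMap ν b)^[n] z)) atTop (𝓝 0) := by
  have hE := tendsto_im_sq_mul_kernelDefect hν b hz hs hstep
  have hR : Tendsto (fun R : ℝ => (‖b + cauchyTransform ν (R * Complex.I)‖ / R) ^ 2) atTop
      (𝓝 0) := by
    have := (((tendsto_cauchyTransform_mul_I hν).const_add (b : ℂ)).norm.mul
      tendsto_inv_atTop_zero).pow 2
    simpa [div_eq_mul_inv] using this
  have hub : ∀ ε : ℝ, 0 < ε → ε ≤ 1 →
      ∀ᶠ n in atTop, kernelNormSq ν ((pickMap ν b)^[n] z) < 5 * ε := by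
    intro ε hε hε1
    -- At `iR` the step is at most `ε² / 4`. Steps never increase, so `H ≤ ε` along the whole orbit
    -- of `iR`; the factor `4` of the comparison lemma plus `ε` for the defect gives `5 ε`.
    obtain ⟨R, hR1, hR0⟩ := ((hR.eventually_lt_const (show (0 : ℝ) < ε ^ 2 / 4 by positivity)).and
      (eventually_gt_atTop 0)).exists
    set w : ℂ := R * Complex.I with hw
    have hwim : w.im = R := by simp [hw]
    have hwpos : 0 < w.im := hwim ▸ hR0
    have hD : hypRatio (pickMap ν b w) w ≤ ε ^ 2 / 4 := by
      refine (step_le_norm_sq_div hν b hwpos).trans ?_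
      rw [hwim]
      exact hR1.le
    have hC := hE.const_mul ((hypRatio w z + 1) ^ 2)
    rw [mul_zero] at hC
    filter_upwards [hC.eventually_lt_const hε] with n hn
    have h1 := kernelNormSq_le_add_kernelDefect hν (im_iterate_pickMap_pos hν b hz n)
      (im_iterate_pickMap_pos hν b hwpos n) (hypRatio_iterate_le hν b hwpos hz n)
    have h2 := kernelNormSq_le_of_step_le hν b hε hε1 (im_iterate_pickMap_pos hν b hwpos n)
      ((step_le hν b hwpos n).trans hD)
    linarith
  rw [tendsto_order]
  refine ⟨fun a ha => Eventually.of_forall fun n => ha.trans_le (kernelNormSq_nonneg _),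
    fun a ha => ?_⟩
  filter_upwards [hub (min (a / 5) 1) (by positivity) (min_le_right _ _)] with n hn
  linarith [min_le_left (a / 5) 1]

/-- If the hyperbolic step along an orbit stays above `s`, the starting point has bounded height. -/
lemma step_mul_im_sq_le (hν : Integrable (fun t : ℝ => (1 + |t|)⁻¹) ν) (b : ℝ)
    {z : ℂ} {s : ℝ} (hz : 0 < z.im) (hs : 0 < s)
    (hstep : ∀ n : ℕ, s ≤ hypRatio ((pickMap ν b)^[n + 1] z) ((pickMap ν b)^[n] z)) :
    s * z.im ^ 2 ≤ 8 * b ^ 2 := by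
  have hH := tendsto_kernelNormSq_iterate hν b hz hs hstep
  have hb := (tendsto_cauchyTransform_mul_I hν).const_add (b : ℂ)
  have hinv : Tendsto (fun R : ℝ => R⁻¹) atTop (𝓝 0) := tendsto_inv_atTop_zero
  have hR : Tendsto (fun R : ℝ => (‖b + cauchyTransform ν (R * Complex.I)‖ / R) ^ 2) atTop
      (𝓝 0) := by
    have := (hb.norm.mul hinv).pow 2
    simpa [div_eq_mul_inv] using this
  -- For `R > 0` this expression is `(hypRatio (iR) z + 2) / R`, the growth rate of the Harnack
  -- constant.
  have hq : Tendsto (fun R : ℝ => ‖(R * Complex.I - z) * (R : ℂ)⁻¹‖ ^ 2 * z.im⁻¹ + 2 * R⁻¹) atTop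
      (𝓝 z.im⁻¹) := by
    have h1 : Tendsto (fun R : ℝ => Complex.I - z * ((R⁻¹ : ℝ) : ℂ)) atTop
        (𝓝 (Complex.I - z * ((0 : ℝ) : ℂ))) :=
      (((Complex.continuous_ofReal.tendsto 0).comp hinv).const_mul z).const_sub Complex.I
    have h2 := ((h1.norm.pow 2).mul_const z.im⁻¹).add (hinv.const_mul 2)
    simp only [Complex.ofReal_zero, mul_zero, sub_zero, Complex.norm_I, one_pow, one_mul,
      add_zero] at h2
    refine h2.congr' ?_
    filter_upwards [eventually_gt_atTop 0] with R hR0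
    have hR1 : (R : ℂ) ≠ 0 := by exact_mod_cast hR0.ne'
    have h3 : (R * Complex.I - z) * (R : ℂ)⁻¹ = Complex.I - z * ((R⁻¹ : ℝ) : ℂ) := by
      push_cast
      field_simp
    rw [h3]
  have hfin := ((hb.norm.mul hq).pow 2).const_mul 8
  have hkey : ∀ᶠ R : ℝ in atTop, s ≤ 8 * (‖b + cauchyTransform ν (R * Complex.I)‖ *
      (‖(R * Complex.I - z) * (R : ℂ)⁻¹‖ ^ 2 * z.im⁻¹ + 2 * R⁻¹)) ^ 2 := by
    filter_upwards [hR.eventually_lt_const (show (0 : ℝ) < 1 ^ 2 / 4 by norm_num),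
      eventually_gt_atTop 0] with R hR1 hR0
    set w : ℂ := R * Complex.I with hw
    have hwim : w.im = R := by simp [hw]
    have hwpos : 0 < w.im := hwim ▸ hR0
    have hDle := step_le_norm_sq_div hν b hwpos
    rw [hwim] at hDle
    set D := hypRatio (pickMap ν b w) w with hDdef
    have hDnn : 0 ≤ D := hypRatio_nonneg (im_pickMap_pos hν b hwpos) hwpos
    set D' := hypRatio w z with hD'def
    have hD'nn : 0 ≤ D' := hypRatio_nonneg hwpos hz
    -- The constant is the one in `hdn`: with `R` fixed, `n` is taken so late that the displacements
    -- at `u` and `v` differ by at most half of the lower bound `√s * Im u`.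
    have hC := hH.const_mul ((D' + 1) * ((D' + 2) ^ 2 + 1))
    rw [mul_zero] at hC
    obtain ⟨n, hn⟩ := (hC.eventually_lt_const (show 0 < √s / 2 by positivity)).exists
    set u := (pickMap ν b)^[n] z with hu
    set v := (pickMap ν b)^[n] w with hv
    have hupos : 0 < u.im := im_iterate_pickMap_pos hν b hz n
    have hvpos : 0 < v.im := im_iterate_pickMap_pos hν b hwpos n
    have hvu : hypRatio v u ≤ D' := hypRatio_iterate_le hν b hwpos hz n
    have hst : hypRatio (pickMap ν b v) v ≤ D := step_le hν b hwpos n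
    have hHv : kernelNormSq ν v ≤ 1 :=
      kernelNormSq_le_of_step_le hν b one_pos le_rfl hvpos (hst.trans (hDle.trans hR1.le))
    have hHu := kernelNormSq_nonneg (ν := ν) u
    have hK : ‖cauchyKernel ν v u‖ ≤ ((D' + 2) ^ 2 + 1) * kernelNormSq ν u := by
      have h1 := two_mul_norm_cauchyKernel_le hν hvpos hupos
      have h2 := kernelNormSq_le_of_hypRatio_le hν hupos hvpos (hypRatio_comm u v ▸ hvu)
      nlinarith [mul_nonneg (sq_nonneg (D' + 2)) hHu]
    have hdiff : (pickMap ν b v - v) - (pickMap ν b u - u) = (v - u) * cauchyKernel ν v u := by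
      have := pickMap_sub_pickMap hν b hvpos hupos
      linear_combination this
    have hdn : ‖(v - u) * cauchyKernel ν v u‖ ≤ √s / 2 * u.im := by
      rw [norm_mul]
      calc ‖v - u‖ * ‖cauchyKernel ν v u‖
          ≤ ((D' + 1) * u.im) * (((D' + 2) ^ 2 + 1) * kernelNormSq ν u) := by
            gcongr
            exact norm_sub_le_of_hypRatio_le hvpos hupos hvu
        _ = ((D' + 1) * ((D' + 2) ^ 2 + 1) * kernelNormSq ν u) * u.im := by ring
        _ ≤ √s / 2 * u.im := by gcongr
    have hlow : √s * u.im ≤ ‖pickMap ν b u - u‖ := by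
      refine abs_le_of_sq_le_sq' ?_ (norm_nonneg _) |>.2
      have hupos' := im_pickMap_pos hν b hupos
      have h1 := hstep n
      rw [Function.iterate_succ_apply', ← hu] at h1
      rw [mul_pow, Real.sq_sqrt hs.le, norm_sub_sq_eq_hypRatio_mul hupos' hupos,
        im_pickMap hν b hupos]
      have h2 : u.im ^ 2 ≤ u.im * (1 + kernelNormSq ν u) * u.im := by nlinarith [mul_pos hupos hupos]
      calc s * u.im ^ 2 ≤ hypRatio (pickMap ν b u) u * u.im ^ 2 := by gcongr
        _ ≤ _ := by
          gcongr
          exact hs.le.trans h1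
    have hlow2 : √s / 2 * u.im ≤ ‖pickMap ν b v - v‖ := by
      have := norm_sub_norm_le (pickMap ν b u - u) (pickMap ν b v - v)
      rw [norm_sub_rev (pickMap ν b u - u), hdiff] at this
      linarith
    have hup : ‖pickMap ν b v - v‖ ^ 2 ≤ D * (2 * ((D' + 2) * u.im) ^ 2) := by
      rw [norm_sub_sq_eq_hypRatio_mul (im_pickMap_pos hν b hvpos) hvpos, im_pickMap hν b hvpos]
      have h1 := im_le_of_hypRatio_le hvpos hupos hvu
      have h2 : v.im * (1 + kernelNormSq ν v) * v.im ≤ 2 * ((D' + 2) * u.im) ^ 2 := by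
        have h3 : v.im ^ 2 ≤ ((D' + 2) * u.im) ^ 2 := by gcongr
        nlinarith [mul_pos hvpos hvpos]
      have h4 := kernelNormSq_nonneg (ν := ν) v
      gcongr
    have h1 : (√s / 2 * u.im) ^ 2 ≤ D * (2 * ((D' + 2) * u.im) ^ 2) :=
      (by gcongr : (√s / 2 * u.im) ^ 2 ≤ ‖pickMap ν b v - v‖ ^ 2).trans hup
    -- `8 = 4 * 2`: the `4` from squaring `√s / 2`, the `2` from `1 + H v ≤ 2`.
    have h2 : s ≤ 8 * (D * (D' + 2) ^ 2) := by
      have hs2 := Real.sq_sqrt hs.le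
      have h3 : s * u.im ^ 2 ≤ 8 * (D * (D' + 2) ^ 2) * u.im ^ 2 := by
        rw [mul_pow, div_pow, hs2] at h1
        linarith
      exact le_of_mul_le_mul_right h3 (by positivity)
    refine h2.trans ?_
    have h3 : ‖b + cauchyTransform ν w‖ * (‖(w - z) * (R : ℂ)⁻¹‖ ^ 2 * z.im⁻¹ + 2 * R⁻¹) =
        ‖b + cauchyTransform ν w‖ / R * (D' + 2) := by
      rw [hD'def, hypRatio, hwim, norm_mul, norm_inv, Complex.norm_real,
        Real.norm_of_nonneg hR0.le]
      field_simp
    rw [h3, mul_pow]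
    gcongr
  -- As `R → ∞`, the factors `R` cancel and the bound tends to `8 (|b| / Im z)²`.
  have h := ge_of_tendsto hfin hkey
  rw [add_zero, mul_pow, Complex.norm_real, Real.norm_eq_abs, sq_abs, inv_pow, ← mul_assoc,
    ← div_eq_mul_inv, le_div_iff₀ (by positivity)] at h
  simpa using h

end Iterates

/-! ### Bounded height and the hyperbolic step -/

section Height

variable {ν : Measure ℝ}

lemma monotone_im_of_orbit (hν : Integrable (fun t : ℝ => (1 + |t|)⁻¹) ν) {b : ℝ} {u : ℕ → ℂ}
    (hpos : ∀ n, 0 < (u n).im) (hu : ∀ n, u (n + 1) = pickMap ν b (u n)) :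
    Monotone fun n => (u n).im := by
  refine monotone_nat_of_le_succ fun n => ?_
  rw [hu n, im_pickMap hν b (hpos n)]
  nlinarith [hpos n, kernelNormSq_nonneg (ν := ν) (u n)]

lemma sum_kernelNormSq_le (hν : Integrable (fun t : ℝ => (1 + |t|)⁻¹) ν) {b : ℝ} {u : ℕ → ℂ}
    (hpos : ∀ n, 0 < (u n).im) (hu : ∀ n, u (n + 1) = pickMap ν b (u n)) (N : ℕ) :
    (u 0).im * ∑ n ∈ Finset.range N, kernelNormSq ν (u n) ≤ (u N).im - (u 0).im := by
  induction N with
  | zero => simp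
  | succ N ih =>
    have h := monotone_im_of_orbit hν hpos hu (Nat.zero_le N)
    rw [Finset.sum_range_succ, mul_add, hu N, im_pickMap hν b (hpos N)]
    nlinarith [mul_le_mul_of_nonneg_right h (kernelNormSq_nonneg (ν := ν) (u N))]

lemma summable_kernelNormSq (hν : Integrable (fun t : ℝ => (1 + |t|)⁻¹) ν) {b L : ℝ} {u : ℕ → ℂ}
    (hpos : ∀ n, 0 < (u n).im) (hu : ∀ n, u (n + 1) = pickMap ν b (u n))
    (hL : ∀ n, (u n).im ≤ L) : Summable fun n => kernelNormSq ν (u n) := by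
  refine summable_of_sum_range_le (c := (L - (u 0).im) / (u 0).im)
    (fun n => kernelNormSq_nonneg _) fun N => ?_
  rw [le_div_iff₀ (hpos 0), mul_comm]
  linarith [sum_kernelNormSq_le hν hpos hu N, hL N]

/-- The height is multiplied by `1 + H ≤ exp H` at each step. -/
lemma im_orbit_le_of_sum_le (hν : Integrable (fun t : ℝ => (1 + |t|)⁻¹) ν) {b S : ℝ} {u : ℕ → ℂ}
    (hpos : ∀ n, 0 < (u n).im) (hu : ∀ n, u (n + 1) = pickMap ν b (u n))
    (hS : ∀ N, ∑ n ∈ Finset.range N, kernelNormSq ν (u n) ≤ S) (N : ℕ) :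
    (u N).im ≤ (u 0).im * Real.exp S := by
  have h : (u N).im ≤ (u 0).im * Real.exp (∑ n ∈ Finset.range N, kernelNormSq ν (u n)) := by
    induction N with
    | zero => simp
    | succ N ih =>
      rw [hu N, im_pickMap hν b (hpos N), Finset.sum_range_succ, Real.exp_add, ← mul_assoc]
      have h1 := kernelNormSq_nonneg (ν := ν) (u N)
      have h2 := Real.add_one_le_exp (kernelNormSq ν (u N))
      have h3 := hpos 0
      gcongr
      linarith
  refine h.trans ?_
  have h3 := hpos 0
  gcongr
  exact hS N

/-- `∏ (1 - k) ≥ 1 - ∑ k ≥ 1 / 2` once the tail of `∑ k` is at most `1 / 2`. -/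
lemma exists_forall_half_le_of_summable {d k : ℕ → ℝ} (hk0 : ∀ n, 0 ≤ k n) (hk : Summable k)
    (hd0 : ∀ n, 0 ≤ d n) (hd : ∀ n, d n * (1 - k n) ≤ d (n + 1)) :
    ∃ N, ∀ m, d N / 2 ≤ d (m + N) := by
  obtain ⟨N, hN⟩ := ((tendsto_sum_nat_add k).eventually_lt_const
    (show (0 : ℝ) < 1 / 2 by norm_num)).exists
  have hsum : ∀ m, ∑ i ∈ Finset.range m, k (i + N) ≤ 1 / 2 := fun m =>
    (((summable_nat_add_iff N).2 hk).sum_le_tsum _ fun i _ => hk0 _).trans hN.le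
  have hind : ∀ m, d N * (1 - ∑ i ∈ Finset.range m, k (i + N)) ≤ d (m + N) := by
    intro m
    induction m with
    | zero => simp
    | succ m ih =>
      have h1 := hd (m + N)
      have h2 := hsum (m + 1)
      have hnn : 0 ≤ ∑ i ∈ Finset.range m, k (i + N) := Finset.sum_nonneg fun i _ => hk0 _
      rw [Finset.sum_range_succ] at h2 ⊢
      have h3 : 0 ≤ 1 - k (m + N) := by linarith
      have h4 := mul_le_mul_of_nonneg_right ih h3
      have h5 := mul_nonneg (hd0 N) (mul_nonneg hnn (hk0 (m + N)))
      rw [show m + 1 + N = m + N + 1 by ring]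
      nlinarith
  refine ⟨N, fun m => (hind m).trans' ?_⟩
  nlinarith [hsum m, hd0 N]

/-- Each displacement is the previous one times `1 + K`, with `|K|` at most the mean of two
consecutive terms of the summable `H`. Displacements thus stay away from zero, and bounded height
turns this into a hyperbolic lower bound. -/
lemma exists_pos_le_step_of_im_le (hν : Integrable (fun t : ℝ => (1 + |t|)⁻¹) ν) {b L : ℝ} {z : ℂ}
    (hz : 0 < z.im) (hne : ∀ n, (pickMap ν b)^[n + 1] z ≠ (pickMap ν b)^[n] z)
    (hL : ∀ n, ((pickMap ν b)^[n] z).im ≤ L) :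
    ∃ s, 0 < s ∧ ∀ n, s ≤ hypRatio ((pickMap ν b)^[n + 1] z) ((pickMap ν b)^[n] z) := by
  set u : ℕ → ℂ := fun n => (pickMap ν b)^[n] z with hudef
  have hpos : ∀ n, 0 < (u n).im := im_iterate_pickMap_pos hν b hz
  have hu : ∀ n, u (n + 1) = pickMap ν b (u n) := fun n => Function.iterate_succ_apply' _ _ _
  have hH := summable_kernelNormSq hν hpos hu hL
  have hk : Summable fun n => (kernelNormSq ν (u (n + 1)) + kernelNormSq ν (u n)) / 2 :=
    (((summable_nat_add_iff 1).2 hH).add hH).div_const 2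
  have hH0 := fun n => kernelNormSq_nonneg (ν := ν) (u n)
  obtain ⟨N, hN⟩ := exists_forall_half_le_of_summable (d := fun n => ‖u (n + 1) - u n‖)
    (fun n => div_nonneg (add_nonneg (hH0 (n + 1)) (hH0 n)) zero_le_two) hk
    (fun n => norm_nonneg _) fun n => by
      rw [hu (n + 1), hu n, pickMap_sub_pickMap hν b (hu n ▸ hpos (n + 1)) (hpos n), norm_mul]
      gcongr
      have h1 := two_mul_norm_cauchyKernel_le hν (hu n ▸ hpos (n + 1)) (hpos n)
      have h2 := norm_sub_le (1 + cauchyKernel ν (pickMap ν b (u n)) (u n))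
        (cauchyKernel ν (pickMap ν b (u n)) (u n))
      rw [add_sub_cancel_right, norm_one] at h2
      linarith
  have hL0 : 0 < L := (hpos 0).trans_le (hL 0)
  have hdN : 0 < ‖u (N + 1) - u N‖ := norm_pos_iff.2 (sub_ne_zero.2 (hne N))
  refine ⟨(‖u (N + 1) - u N‖ / 2) ^ 2 / (L * L), by positivity, fun n => ?_⟩
  -- The bound holds only from `N` on; monotonicity of the step carries it back to `n`.
  refine le_trans ?_ (antitone_step hν b hz (Nat.le_add_right n N))
  have h1 := hpos (n + N)
  have h2 := hpos (n + N + 1)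
  change _ ≤ ‖u (n + N + 1) - u (n + N)‖ ^ 2 / ((u (n + N + 1)).im * (u (n + N)).im)
  have h3 := hL (n + N)
  have h4 := hL (n + N + 1)
  gcongr
  exact hN n

lemma im_iterate_sq_le_of_le_step (hν : Integrable (fun t : ℝ => (1 + |t|)⁻¹) ν) (b : ℝ)
    {z : ℂ} {s : ℝ} (hz : 0 < z.im) (hs : 0 < s)
    (hstep : ∀ n : ℕ, s ≤ hypRatio ((pickMap ν b)^[n + 1] z) ((pickMap ν b)^[n] z)) (n : ℕ) :
    s * ((pickMap ν b)^[n] z).im ^ 2 ≤ 8 * b ^ 2 := by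
  refine step_mul_im_sq_le hν b (im_iterate_pickMap_pos hν b hz n) hs fun m => ?_
  rw [← Function.iterate_add_apply, ← Function.iterate_add_apply]
  simpa only [add_right_comm] using hstep (m + n)

lemma tendsto_step_zero_or (hν : Integrable (fun t : ℝ => (1 + |t|)⁻¹) ν) (b : ℝ) {z : ℂ}
    (hz : 0 < z.im) :
    Tendsto (fun n => hypRatio ((pickMap ν b)^[n + 1] z) ((pickMap ν b)^[n] z)) atTop (𝓝 0) ∨
      ∃ s, 0 < s ∧ ∀ n, s ≤ hypRatio ((pickMap ν b)^[n + 1] z) ((pickMap ν b)^[n] z) := by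
  have hanti := antitone_step hν b hz
  have hnn : ∀ n, 0 ≤ hypRatio ((pickMap ν b)^[n + 1] z) ((pickMap ν b)^[n] z) := fun n =>
    hypRatio_nonneg (im_iterate_pickMap_pos hν b hz _) (im_iterate_pickMap_pos hν b hz _)
  have hbdd : BddBelow (Set.range fun n =>
      hypRatio ((pickMap ν b)^[n + 1] z) ((pickMap ν b)^[n] z)) :=
    ⟨0, by rintro _ ⟨n, rfl⟩; exact hnn n⟩
  have hlim := tendsto_atTop_ciInf hanti hbdd
  rcases (le_ciInf hnn).eq_or_lt with h | h
  · left
    rwa [← h] at hlim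
  · exact Or.inr ⟨_, h, fun n => ciInf_le hbdd n⟩

/-- The hyperbolic step along an orbit tends to zero exactly when the heights are unbounded. -/
lemma tendsto_step_zero_iff (hν : Integrable (fun t : ℝ => (1 + |t|)⁻¹) ν) (b : ℝ) {z : ℂ}
    (hz : 0 < z.im) (hne : ∀ n, (pickMap ν b)^[n + 1] z ≠ (pickMap ν b)^[n] z) :
    Tendsto (fun n => hypRatio ((pickMap ν b)^[n + 1] z) ((pickMap ν b)^[n] z)) atTop (𝓝 0) ↔
      Tendsto (fun n => ((pickMap ν b)^[n] z).im) atTop atTop := by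
  constructor
  · intro h
    refine (tendsto_atTop_of_monotone (monotone_im_of_orbit hν (b := b)
      (im_iterate_pickMap_pos hν b hz) fun n => Function.iterate_succ_apply' _ _ _)).resolve_right ?_
    rintro ⟨l, hl⟩
    obtain ⟨L, hL⟩ := hl.bddAbove_range
    obtain ⟨s, hs, hstep⟩ := exists_pos_le_step_of_im_le hν hz hne fun n => hL ⟨n, rfl⟩
    exact hs.not_ge (ge_of_tendsto' h hstep)
  · intro h
    refine (tendsto_step_zero_or hν b hz).resolve_right ?_
    rintro ⟨s, hs, hstep⟩
    -- The `+ 1` makes the height exceed `1`, hence its square exceeds it.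
    obtain ⟨n, hn⟩ := (h.eventually_gt_atTop (8 * b ^ 2 / s + 1)).exists
    have h1 := im_iterate_sq_le_of_le_step hν b hz hs hstep n
    rw [mul_comm, ← le_div_iff₀ hs] at h1
    have h2 : 0 ≤ 8 * b ^ 2 / s := by positivity
    nlinarith

lemma tendsto_im_iterate_of_tendsto (hν : Integrable (fun t : ℝ => (1 + |t|)⁻¹) ν) (b : ℝ)
    {z w : ℂ} (hz : 0 < z.im) (hw : 0 < w.im)
    (h : Tendsto (fun n => ((pickMap ν b)^[n] z).im) atTop atTop) :
    Tendsto (fun n => ((pickMap ν b)^[n] w).im) atTop atTop := by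
  have hD := hypRatio_nonneg hz hw
  refine tendsto_atTop_mono (fun n => ?_) (h.const_mul_atTop
    (show 0 < (hypRatio z w + 2)⁻¹ by positivity))
  rw [inv_mul_le_iff₀ (by positivity)]
  exact im_le_of_hypRatio_le (im_iterate_pickMap_pos hν b hz n) (im_iterate_pickMap_pos hν b hw n)
    (hypRatio_iterate_le hν b hz hw n)

lemma tendsto_step_zero_of_eq_zero (hν : Integrable (fun t : ℝ => (1 + |t|)⁻¹) ν) {z : ℂ}
    (hz : 0 < z.im) :
    Tendsto (fun n => hypRatio ((pickMap ν 0)^[n + 1] z) ((pickMap ν 0)^[n] z)) atTop (𝓝 0) := by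
  refine (tendsto_step_zero_or hν 0 hz).resolve_right ?_
  rintro ⟨s, hs, hstep⟩
  have h := step_mul_im_sq_le hν 0 hz hs hstep
  have : 0 < s * z.im ^ 2 := by positivity
  simp only [ne_eq, OfNat.ofNat_ne_zero, not_false_eq_true, zero_pow, mul_zero] at h
  linarith

end Height

/-! ### The pseudo-hyperbolic distance -/

lemma norm_sub_conj_sq (z w : ℂ) : ‖z - conj w‖ ^ 2 = ‖z - w‖ ^ 2 + 4 * (z.im * w.im) := by
  simp only [Complex.sq_norm, Complex.normSq_apply, Complex.sub_re, Complex.sub_im,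
    Complex.conj_re, Complex.conj_im]
  ring

lemma pseudoHyperbolicDist_sq (z w : ℍ) :
    pseudoHyperbolicDist z w ^ 2 = hypRatio z w / (hypRatio z w + 4) := by
  have h1 : 0 < (z : ℂ).im := z.im_pos
  have h2 : 0 < (w : ℂ).im := w.im_pos
  rw [pseudoHyperbolicDist, div_pow, norm_sub_conj_sq, hypRatio]
  field_simp

lemma tendsto_pseudoHyperbolicDist_iff {z w : ℕ → ℍ} :
    Tendsto (fun n => pseudoHyperbolicDist (z n) (w n)) atTop (𝓝 0) ↔
      Tendsto (fun n => hypRatio (z n) (w n)) atTop (𝓝 0) := by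
  have hnn : ∀ n, 0 ≤ hypRatio (z n) (w n) := fun n =>
    hypRatio_nonneg (z n).im_pos (w n).im_pos
  constructor
  · intro h
    have h2 : Tendsto (fun n => 4 * pseudoHyperbolicDist (z n) (w n) ^ 2 /
        (1 - pseudoHyperbolicDist (z n) (w n) ^ 2)) atTop (𝓝 (4 * 0 ^ 2 / (1 - 0 ^ 2))) :=
      ((h.pow 2).const_mul 4).div ((h.pow 2).const_sub 1) (by norm_num)
    norm_num at h2
    refine h2.congr fun n => ?_
    have := hnn n
    rw [pseudoHyperbolicDist_sq]
    field_simp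
    ring
  · intro h
    have h2 : Tendsto (fun n => pseudoHyperbolicDist (z n) (w n) ^ 2) atTop (𝓝 (0 / (0 + 4))) := by
      simp_rw [pseudoHyperbolicDist_sq]
      exact h.div (h.add_const 4) (by norm_num)
    have h3 := h2.sqrt
    simp only [zero_div, Real.sqrt_zero] at h3
    refine h3.congr fun n => Real.sqrt_sq ?_
    unfold pseudoHyperbolicDist
    positivity

/-! ### Reflection in the imaginary axis -/

section Reflection

variable {ν : Measure ℝ}

lemma integrable_weight_map_neg (hν : Integrable (fun t : ℝ => (1 + |t|)⁻¹) ν) :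
    Integrable (fun t : ℝ => (1 + |t|)⁻¹) (ν.map fun t => -t) := by
  rw [show (fun t : ℝ => -t) = MeasurableEquiv.neg ℝ from rfl, integrable_map_equiv]
  simpa [Function.comp_def] using hν

lemma neg_conj_kernel (z : ℂ) (t : ℝ) :
    (((-t : ℝ) : ℂ) - -conj z)⁻¹ = -conj ((t : ℂ) - z)⁻¹ := by
  rw [map_inv₀, map_sub, Complex.conj_ofReal, ← inv_neg]
  push_cast
  congr 1
  ring

lemma kernelNormSq_map_neg (z : ℂ) :
    kernelNormSq (ν.map fun t => -t) (-conj z) = kernelNormSq ν z := by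
  rw [kernelNormSq, show (fun t : ℝ => -t) = MeasurableEquiv.neg ℝ from rfl, integral_map_equiv]
  change ∫ t : ℝ, ‖(((-t : ℝ) : ℂ) - -conj z)⁻¹‖ ^ 2 ∂ν = _
  simp only [neg_conj_kernel, norm_neg, Complex.norm_conj, kernelNormSq]

/-- Reflection reverses the drift; it serves both for `b < 0` and for excluding escape to the left
when `b > 0`. -/
lemma pickMap_map_neg (b : ℝ) (z : ℂ) :
    pickMap (ν.map fun t => -t) (-b) (-conj z) = -conj (pickMap ν b z) := by
  have h : cauchyTransform (ν.map fun t => -t) (-conj z) = -conj (cauchyTransform ν z) := by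
    rw [cauchyTransform, cauchyTransform, ← integral_conj, ← integral_neg,
      show (fun t : ℝ => -t) = MeasurableEquiv.neg ℝ from rfl, integral_map_equiv]
    exact integral_congr_ae (Eventually.of_forall fun t => neg_conj_kernel z t)
  rw [pickMap, pickMap, h]
  simp only [map_add, Complex.conj_ofReal]
  push_cast
  ring

lemma map_neg_Ioi : (ν.map fun t => -t) (Set.Ioi 0) = ν (Set.Iio 0) := by
  rw [Measure.map_apply measurable_neg measurableSet_Ioi]
  congr 1
  ext t
  simp

end Reflection

/-! ### Orbits of bounded height -/

section Bounded

variable {ν : Measure ℝ}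

lemma measure_Icc_lt_top_of_integrable_weight (hν : Integrable (fun t : ℝ => (1 + |t|)⁻¹) ν) (a c : ℝ) :
    ν (Set.Icc a c) < ⊤ := by
  refine (measure_mono fun t ht => ?_).trans_lt
    (hν.measure_ge_lt_top (ε := (1 + (|a| + |c|))⁻¹) (by positivity))
  simp only [Set.mem_ofPred_eq]
  gcongr
  rw [abs_le]
  constructor <;> cases abs_cases a <;> cases abs_cases c <;> linarith [ht.1, ht.2]

/-- A sequence with bounded heights and gaps covers the half-line up to bounded distance. -/
lemma measure_Ioi_lt_top_of_tendsto (hν : Integrable (fun t : ℝ => (1 + |t|)⁻¹) ν) {C L : ℝ}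
    {u : ℕ → ℂ} (hpos : ∀ n, 0 < (u n).im) (hL : ∀ n, (u n).im ≤ L)
    (hgap : ∀ n, (u (n + 1)).re ≤ (u n).re + C)
    (hsum : Summable fun n => kernelNormSq ν (u n))
    (hlim : Tendsto (fun n => (u n).re) atTop atTop) : ν (Set.Ioi 0) < ⊤ := by
  have hL0 : 0 < L := (hpos 0).trans_le (hL 0)
  set c : ℝ := (C ^ 2 + L ^ 2)⁻¹ with hc
  have hc0 : 0 < c := by positivity
  -- With `m + 1` the first index whose real part exceeds `t`, the point `u m` lies within `C`
  -- horizontally and `L` vertically of `t`.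
  have hcover : ∀ t : ℝ, (u 0).re ≤ t → ∃ n, c ≤ ‖((t : ℂ) - u n)⁻¹‖ ^ 2 := by
    intro t ht
    have hex : ∃ n, t < (u n).re := (hlim.eventually_gt_atTop t).exists
    classical
    obtain ⟨m, hm⟩ : ∃ m, Nat.find hex = m + 1 := by
      refine Nat.exists_eq_succ_of_ne_zero fun h => ?_
      have := Nat.find_spec hex
      rw [h] at this
      linarith
    have h1 := Nat.find_spec hex
    have h2 := Nat.find_min hex (m := m) (by omega)
    rw [hm] at h1
    refine ⟨m, ?_⟩
    rw [norm_inv, inv_pow, norm_ofReal_sub_sq, hc]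
    have h3 := hpos m
    have h4 := hL m
    have h5 := hgap m
    have h6 : 0 ≤ t - (u m).re := by linarith
    have h7 : t - (u m).re ≤ C := by linarith
    gcongr
  have hlin : ∫⁻ t, ∑' n, ENNReal.ofReal (‖((t : ℂ) - u n)⁻¹‖ ^ 2) ∂ν < ⊤ := by
    rw [lintegral_tsum fun n =>
      ((measurable_kernel (u n)).norm.pow_const 2).ennreal_ofReal.aemeasurable]
    have h1 : ∀ n, ∫⁻ t, ENNReal.ofReal (‖((t : ℂ) - u n)⁻¹‖ ^ 2) ∂ν =
        ENNReal.ofReal (kernelNormSq ν (u n)) := fun n =>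
      (ofReal_integral_eq_lintegral_ofReal (integrable_norm_kernel_sq hν (hpos n))
        (Eventually.of_forall fun t => by positivity)).symm
    simp_rw [h1]
    exact hsum.tsum_ofReal_lt_top
  -- Markov's inequality: the sum of squared kernels is at least `c` on this half-line, and its
  -- integral is `∑ H < ∞`.
  have hIci : ν (Set.Ici (u 0).re) < ⊤ := by
    refine (measure_mono (t := {t : ℝ | ENNReal.ofReal c ≤
      ∑' n, ENNReal.ofReal (‖((t : ℂ) - u n)⁻¹‖ ^ 2)}) fun t ht => ?_).trans_lt
      ((meas_ge_le_lintegral_div (Measurable.tsum fun n =>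
        ((measurable_kernel (u n)).norm.pow_const 2).ennreal_ofReal).aemeasurable
        (by simpa using hc0) ENNReal.ofReal_ne_top).trans_lt
        (ENNReal.div_lt_top hlin.ne (by simpa using hc0)))
    obtain ⟨n, hn⟩ := hcover t ht
    exact (ENNReal.ofReal_le_ofReal hn).trans (ENNReal.le_tsum n)
  refine (measure_mono (t := Set.Icc 0 (u 0).re ∪ Set.Ici (u 0).re) fun t ht => ?_).trans_lt
    (measure_union_lt_top (measure_Icc_lt_top_of_integrable_weight hν _ _) hIci)
  rcases le_total t (u 0).re with h | h
  · exact Or.inl ⟨le_of_lt ht, h⟩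
  · exact Or.inr h

/-- Once `|x n| > C`, a jump of size at most `C` cannot change the sign. -/
lemma tendsto_atTop_or_atBot_of_abs {x : ℕ → ℝ} {C : ℝ}
    (habs : Tendsto (fun n => |x n|) atTop atTop) (hgap : ∀ n, |x (n + 1) - x n| ≤ C) :
    Tendsto x atTop atTop ∨ Tendsto x atTop atBot := by
  obtain ⟨N, hN⟩ := eventually_atTop.1 (habs.eventually_gt_atTop C)
  have hC : 0 ≤ C := (abs_nonneg _).trans (hgap 0)
  rcases le_total 0 (x N) with h | h
  · left
    have hind : ∀ n, N ≤ n → 0 ≤ x n := by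
      intro n hn
      induction n, hn using Nat.le_induction with
      | base => exact h
      | succ n hn ih =>
        have h1 := hN n hn
        rw [abs_of_nonneg ih] at h1
        linarith [(abs_le.1 (hgap n)).1]
    refine habs.congr' ?_
    filter_upwards [eventually_ge_atTop N] with n hn
    exact abs_of_nonneg (hind n hn)
  · right
    have hind : ∀ n, N ≤ n → x n ≤ 0 := by
      intro n hn
      induction n, hn using Nat.le_induction with
      | base => exact h
      | succ n hn ih =>
        have h1 := hN n hn
        rw [abs_of_nonpos ih] at h1
        linarith [(abs_le.1 (hgap n)).2]
    refine (tendsto_neg_atTop_atBot.comp habs).congr' ?_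
    filter_upwards [eventually_ge_atTop N] with n hn
    simp [abs_of_nonpos (hind n hn)]

/-- When `Re u ≤ 0`, only the mass on `t < 0` pulls to the left. Being finite, its pull tends to
zero by dominated convergence as `Re u → -∞`, so the drift `b` wins and real parts eventually stop
decreasing. -/
lemma not_tendsto_re_atBot (hν : Integrable (fun t : ℝ => (1 + |t|)⁻¹) ν) {b : ℝ} (hb : 0 < b)
    {u : ℕ → ℂ} (hpos : ∀ n, 0 < (u n).im) (hu : ∀ n, u (n + 1) = pickMap ν b (u n))
    (hfin : ν (Set.Iio 0) < ⊤) : ¬ Tendsto (fun n => (u n).re) atTop atBot := by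
  intro hlim
  have hmono := monotone_im_of_orbit hν hpos hu
  have : IsFiniteMeasure (ν.restrict (Set.Iio 0)) := ⟨by simpa using hfin⟩
  have hg : Tendsto (fun n => ∫ t in Set.Iio (0 : ℝ), ‖((t : ℂ) - u n)⁻¹‖ ∂ν) atTop (𝓝 0) := by
    have h := tendsto_integral_of_dominated_convergence (μ := ν.restrict (Set.Iio 0))
      (F := fun n (t : ℝ) => ‖((t : ℂ) - u n)⁻¹‖) (f := fun _ => (0 : ℝ))
      (fun _ => (u 0).im⁻¹) (fun n => (measurable_kernel (u n)).norm.aestronglyMeasurable)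
      (integrable_const _) (fun n => Eventually.of_forall fun t => ?_)
      (Eventually.of_forall fun t => ?_)
    · simpa using h
    · rw [norm_norm]
      exact (norm_kernel_le (hpos n) t).trans (inv_anti₀ (hpos 0) (hmono (Nat.zero_le n)))
    · have h1 : Tendsto (fun n => ‖(t : ℂ) - u n‖) atTop atTop := by
        refine tendsto_atTop_mono (fun n => ?_) (tendsto_atTop_add_const_left _ t
          (tendsto_neg_atBot_atTop.comp hlim))
        have := Complex.re_le_norm ((t : ℂ) - u n)
        simpa [sub_eq_add_neg] using this
      simpa only [norm_inv, Function.comp_def] using tendsto_inv_atTop_zero.comp h1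
  obtain ⟨N, hN⟩ := eventually_atTop.1 ((hg.eventually_lt_const hb).and
    (hlim.eventually_le_atBot 0))
  have hstep : ∀ n, N ≤ n → (u n).re ≤ (u (n + 1)).re := by
    intro n hn
    obtain ⟨h1, h2⟩ := hN n hn
    have hre : (cauchyTransform ν (u n)).re = ∫ t : ℝ, (((t : ℂ) - u n)⁻¹).re ∂ν :=
      (integral_re (integrable_kernel hν (hpos n))).symm
    have hint := (integrable_kernel hν (hpos n)).norm
    have hle : -∫ t in Set.Iio (0 : ℝ), ‖((t : ℂ) - u n)⁻¹‖ ∂ν ≤ (cauchyTransform ν (u n)).re := by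
      rw [hre, ← integral_indicator measurableSet_Iio, ← integral_neg]
      refine integral_mono (hint.indicator measurableSet_Iio).neg
        (integrable_kernel hν (hpos n)).re fun t => ?_
      by_cases ht : t < 0
      · simp only [Set.indicator_of_mem (Set.mem_Iio.2 ht)]
        exact (abs_le.1 (Complex.abs_re_le_norm _)).1
      · rw [Set.indicator_of_notMem (by simpa using ht), neg_zero]
        change 0 ≤ (((t : ℂ) - u n)⁻¹).re
        rw [re_kernel]
        have : 0 ≤ t - (u n).re := by linarith
        positivity
    rw [hu n, pickMap, Complex.add_re, Complex.add_re, Complex.ofReal_re]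
    linarith
  obtain ⟨n, hn1, hn2⟩ := ((hlim.eventually_lt_atBot (u N).re).and (eventually_ge_atTop N)).exists
  exact hn1.not_ge (Nat.le_induction le_rfl (fun n hn ih => ih.trans (hstep n hn)) n hn2)

/-- An escaping orbit of bounded height and positive drift forces finite mass on the right. -/
lemma measure_Ioi_lt_top_of_im_le (hν : Integrable (fun t : ℝ => (1 + |t|)⁻¹) ν) {b L : ℝ}
    (hb : 0 < b) {u : ℕ → ℂ} (hpos : ∀ n, 0 < (u n).im)
    (hu : ∀ n, u (n + 1) = pickMap ν b (u n)) (hL : ∀ n, (u n).im ≤ L)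
    (hesc : Tendsto (fun n => ‖u n‖) atTop atTop) : ν (Set.Ioi 0) < ⊤ := by
  have hsum := summable_kernelNormSq hν hpos hu hL
  set D := hypRatio (u 1) (u 0) with hD
  have hDn : ∀ n, hypRatio (u (n + 1)) (u n) ≤ D := by
    intro n
    induction n with
    | zero => exact le_rfl
    | succ n ih =>
      refine le_trans ?_ ih
      conv_lhs => rw [hu (n + 1), hu n]
      rw [hu n]
      exact hypRatio_pickMap_le hν b (hu n ▸ hpos (n + 1)) (hpos n)
  have hD0 : 0 ≤ D := hypRatio_nonneg (hpos 1) (hpos 0)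
  have hgap : ∀ n, |(u (n + 1)).re - (u n).re| ≤ (D + 1) * L := fun n => by
    rw [← Complex.sub_re]
    refine (Complex.abs_re_le_norm _).trans
      ((norm_sub_le_of_hypRatio_le (hpos (n + 1)) (hpos n) (hDn n)).trans ?_)
    gcongr
    exact hL n
  have habs : Tendsto (fun n => |(u n).re|) atTop atTop := by
    refine tendsto_atTop_mono (fun n => ?_) (tendsto_atTop_add_const_right _ (-L) hesc)
    have h1 := Complex.norm_le_abs_re_add_abs_im (u n)
    rw [abs_of_pos (hpos n)] at h1
    linarith [hL n]
  rcases tendsto_atTop_or_atBot_of_abs habs hgap with h | h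
  · exact measure_Ioi_lt_top_of_tendsto (C := (D + 1) * L) hν hpos hL
      (fun n => by linarith [(abs_le.1 (hgap n)).2]) hsum h
  -- Escape to the left would, by the reflected covering argument, make `ν (Set.Iio 0)` finite.
  · refine absurd h (not_tendsto_re_atBot hν hb hpos hu ?_)
    rw [← map_neg_Ioi]
    refine measure_Ioi_lt_top_of_tendsto (C := (D + 1) * L) (L := L) (u := fun n => -conj (u n))
      (integrable_weight_map_neg hν)
      (by simpa using hpos) (by simpa using hL) (fun n => ?_) ?_ ?_
    · simp only [Complex.neg_re, Complex.conj_re]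
      linarith [(abs_le.1 (hgap n)).1]
    · simpa only [kernelNormSq_map_neg] using hsum
    · simpa only [Complex.neg_re, Complex.conj_re, Function.comp_def] using
        tendsto_neg_atBot_atTop.comp h

/-! ### Bounded orbits from finite mass on the right -/

/-- Mean value theorem on `[v, v + d]`, where `1 + ξ² ≤ (2 + 2 d²)(1 + v²)`. It makes `∑ 1 / (v n ²
+ 1)` telescope when the gaps are at least `d`. -/
lemma inv_sq_add_one_le_arctan_sub {d : ℝ} (hd : 0 < d) {v w : ℝ} (hw : v + d ≤ w) :
    (v ^ 2 + 1)⁻¹ ≤ (2 + 2 * d ^ 2) / d * (Real.arctan w - Real.arctan v) := by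
  obtain ⟨ξ, ⟨h1, h2⟩, h3⟩ := exists_deriv_eq_slope Real.arctan (show v < v + d by linarith)
    Real.continuous_arctan.continuousOn Real.differentiable_arctan.differentiableOn
  rw [Real.deriv_arctan, add_sub_cancel_left, eq_div_iff hd.ne'] at h3
  have h4 : Real.arctan (v + d) ≤ Real.arctan w := Real.arctan_strictMono.monotone hw
  have h5 : 1 + ξ ^ 2 ≤ (2 + 2 * d ^ 2) * (v ^ 2 + 1) := by
    have h6 : ξ ^ 2 ≤ 2 * v ^ 2 + 2 * d ^ 2 := by
      have : (ξ - v) ^ 2 ≤ d ^ 2 := by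
        have h7 : 0 ≤ ξ - v := by linarith
        gcongr
        linarith
      nlinarith [sq_nonneg (ξ - 2 * v)]
    nlinarith [mul_nonneg (sq_nonneg d) (sq_nonneg v)]
  calc (v ^ 2 + 1)⁻¹ ≤ (2 + 2 * d ^ 2) * (1 / (1 + ξ ^ 2)) := by
        rw [mul_one_div, le_div_iff₀ (by positivity), inv_mul_le_iff₀ (by positivity)]
        linarith
    _ = (2 + 2 * d ^ 2) / d * (1 / (1 + ξ ^ 2) * d) := by field_simp
    _ ≤ _ := by
        rw [h3]
        gcongr

lemma pi_div_two_sub_arctan_le {s : ℝ} (hs : 0 ≤ s) :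
    Real.pi / 2 - Real.arctan s ≤ 4 * (1 + s)⁻¹ := by
  rw [← div_eq_mul_inv, le_div_iff₀ (by positivity)]
  have h0 : 0 ≤ Real.arctan s := Real.arctan_nonneg.2 hs
  have h1 := Real.pi_lt_four
  rcases le_total s 1 with h | h
  · nlinarith
  · have hpos : 0 < s := by linarith
    rw [← Real.arctan_inv_of_pos hpos]
    have h2 : Real.arctan s⁻¹ ≤ s⁻¹ := by
      simpa only [Real.tan_arctan] using
        Real.le_tan (Real.arctan_nonneg.2 (inv_nonneg.2 hs)) (Real.arctan_lt_pi_div_two s⁻¹)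
    calc Real.arctan s⁻¹ * (1 + s) ≤ s⁻¹ * (s + s) := by gcongr
      _ ≤ 4 := by field_simp; norm_num

/-- The function is at most `π` on the right, where the mass is finite, and decays like `1 / |t|` on
the left, where the weight takes over. -/
lemma integrable_pi_div_two_add_arctan (hν : Integrable (fun t : ℝ => (1 + |t|)⁻¹) ν)
    (hfin : ν (Set.Ioi 0) < ⊤) : Integrable (fun t : ℝ => Real.pi / 2 + Real.arctan t) ν := by
  have h1 : Integrable ((Set.Ioi (0 : ℝ)).indicator fun _ => Real.pi) ν :=
    (integrable_indicator_iff measurableSet_Ioi).2 (integrableOn_const hfin.ne)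
  refine (h1.add (hν.const_mul 4)).mono' (by fun_prop) (Eventually.of_forall fun t => ?_)
  have h2 := Real.neg_pi_div_two_lt_arctan t
  have h3 := Real.arctan_lt_pi_div_two t
  rw [Real.norm_of_nonneg (by linarith), Pi.add_apply]
  by_cases ht : 0 < t
  · rw [Set.indicator_of_mem (Set.mem_Ioi.2 ht)]
    have : 0 ≤ 4 * (1 + |t|)⁻¹ := by positivity
    linarith
  · rw [Set.indicator_of_notMem (by simpa using ht), zero_add]
    have h4 := pi_div_two_sub_arctan_le (s := -t) (by linarith)
    rw [Real.arctan_neg] at h4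
    rw [abs_of_nonpos (by linarith)]
    linarith

lemma exists_norm_cauchyTransform_le (hν : Integrable (fun t : ℝ => (1 + |t|)⁻¹) ν)
    (hfin : ν (Set.Ioi 0) < ⊤) {ε : ℝ} (hε : 0 < ε) :
    ∃ Y : ℝ, 1 ≤ Y ∧ ∀ z : ℂ, 0 ≤ z.re → Y ≤ z.im → ‖cauchyTransform ν z‖ ≤ ε := by
  -- `g Y` majorizes the kernel when `Re z ≥ 0` and `Im z ≥ Y`: by `1 / Y` for `t > 0`, and for `t ≤
  -- 0` because `|t - z|` exceeds both `Y` and `|t|`. It decreases in `Y`, so `g 1` dominates.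
  set g : ℝ → ℝ → ℝ := fun Y t =>
    (Set.Ioi (0 : ℝ)).indicator (fun _ => Y⁻¹) t + 2 * (Y + |t|)⁻¹ with hg
  have hmeas : ∀ Y, AEStronglyMeasurable (g Y) ν := fun Y =>
    ((measurable_const.indicator measurableSet_Ioi).add (by fun_prop)).aestronglyMeasurable
  have hdom : Integrable (g 1) ν :=
    ((integrable_indicator_iff measurableSet_Ioi).2 (integrableOn_const hfin.ne)).add
      (hν.const_mul 2)
  have hg0 : ∀ Y, 1 ≤ Y → ∀ t, 0 ≤ g Y t := fun Y hY t =>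
    add_nonneg (Set.indicator_nonneg (fun _ _ => by positivity) _) (by positivity)
  have hle : ∀ Y, 1 ≤ Y → ∀ t, ‖g Y t‖ ≤ g 1 t := fun Y hY t => by
    rw [Real.norm_of_nonneg (hg0 Y hY t)]
    simp only [hg]
    gcongr
  have hlim : Tendsto (fun Y => ∫ t, g Y t ∂ν) atTop (𝓝 0) := by
    have h : Tendsto (fun Y => ∫ t, g Y t ∂ν) atTop (𝓝 (∫ _ : ℝ, (0 : ℝ) ∂ν)) := by
      refine tendsto_integral_filter_of_dominated_convergence (g 1)
        (Eventually.of_forall hmeas) ?_ hdom (Eventually.of_forall fun t => ?_)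
      · filter_upwards [eventually_ge_atTop 1] with Y hY
        exact Eventually.of_forall (hle Y hY)
      · have h1 : Tendsto (fun Y : ℝ => (Set.Ioi (0 : ℝ)).indicator (fun _ => Y⁻¹) t) atTop
            (𝓝 0) := by
          by_cases ht : t ∈ Set.Ioi (0 : ℝ)
          · simpa only [Set.indicator_of_mem ht] using tendsto_inv_atTop_zero
          · simp only [Set.indicator_of_notMem ht, tendsto_const_nhds]
        have h2 : Tendsto (fun Y : ℝ => 2 * (Y + |t|)⁻¹) atTop (𝓝 0) := by
          simpa using (tendsto_inv_atTop_zero.comp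
            (tendsto_atTop_add_const_right _ |t| tendsto_id)).const_mul (2 : ℝ)
        simpa using h1.add h2
    simpa using h
  obtain ⟨Y, hY1, hY2⟩ := ((hlim.eventually_lt_const hε).and (eventually_ge_atTop 1)).exists
  refine ⟨Y, hY2, fun z hre him => le_trans ?_ hY1.le⟩
  have hz : 0 < z.im := by linarith
  refine norm_integral_le_of_norm_le (hdom.mono' (hmeas Y) (Eventually.of_forall (hle Y hY2)))
    (Eventually.of_forall fun t => ?_)
  have h1 := im_le_norm_ofReal_sub z t
  by_cases ht : 0 < t
  · simp only [hg, Set.indicator_of_mem (Set.mem_Ioi.2 ht)]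
    have h2 : 0 ≤ 2 * (Y + |t|)⁻¹ := by positivity
    have h3 : ‖((t : ℂ) - z)⁻¹‖ ≤ Y⁻¹ :=
      (norm_kernel_le hz t).trans (inv_anti₀ (by linarith) him)
    linarith
  · have h2 : |t| ≤ ‖(t : ℂ) - z‖ := by
      have h3 := Complex.abs_re_le_norm ((t : ℂ) - z)
      rw [Complex.sub_re, Complex.ofReal_re, abs_of_nonpos (by linarith)] at h3
      rw [abs_of_nonpos (by linarith)]
      linarith
    simp only [hg, Set.indicator_of_notMem (show t ∉ Set.Ioi 0 by simpa using ht), zero_add]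
    rw [norm_inv, ← div_eq_mul_inv, le_div_iff₀ (by positivity),
      inv_mul_le_iff₀ (norm_ofReal_sub_pos hz t)]
    linarith

/-- With positive drift and finite mass on the right, some orbit has bounded height. -/
lemma exists_im_le_of_measure_Ioi_lt_top (hν : Integrable (fun t : ℝ => (1 + |t|)⁻¹) ν) {b : ℝ}
    (hb : 0 < b) (hfin : ν (Set.Ioi 0) < ⊤) :
    ∃ Y : ℝ, 0 < Y ∧ ∀ u : ℕ → ℂ, u 0 = Y * Complex.I → (∀ n, 0 < (u n).im) →
      (∀ n, u (n + 1) = pickMap ν b (u n)) → ∃ L, ∀ n, (u n).im ≤ L := by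
  obtain ⟨Y, hY, hYle⟩ := exists_norm_cauchyTransform_le hν hfin (half_pos hb)
  refine ⟨Y, by linarith, fun u hu0 hpos hu => ?_⟩
  have him : ∀ n, Y ≤ (u n).im := fun n => by
    simpa [hu0] using monotone_im_of_orbit hν hpos hu (Nat.zero_le n)
  have hmove : ∀ n, 0 ≤ (u n).re → (u n).re + b / 2 ≤ (u (n + 1)).re := fun n hn => by
    have h1 := (abs_le.1 ((Complex.abs_re_le_norm _).trans (hYle (u n) hn (him n)))).1
    rw [hu n, pickMap, Complex.add_re, Complex.add_re, Complex.ofReal_re]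
    linarith
  have hre : ∀ n, 0 ≤ (u n).re := fun n => by
    induction n with
    | zero => simp [hu0]
    | succ n ih => linarith [hmove n ih]
  set C : ℝ := (2 + 2 * (b / 2) ^ 2) / (b / 2) with hC
  have hC0 : 0 < C := by positivity
  -- Heights are at least `Y ≥ 1`, so `|t - u n|² ≥ (Re u n - t)² + 1`; the start `Re u 0 = 0`
  -- leaves the term `arctan t`.
  have hbound : ∀ N (t : ℝ), ∑ n ∈ Finset.range N, ‖((t : ℂ) - u n)⁻¹‖ ^ 2 ≤
      C * (Real.pi / 2 + Real.arctan t) := by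
    intro N t
    have h1 : ∀ n, ‖((t : ℂ) - u n)⁻¹‖ ^ 2 ≤
        C * (Real.arctan ((u (n + 1)).re - t) - Real.arctan ((u n).re - t)) := fun n => by
      refine le_trans ?_ (inv_sq_add_one_le_arctan_sub (half_pos hb)
        (show (u n).re - t + b / 2 ≤ (u (n + 1)).re - t by linarith [hmove n (hre n)]))
      rw [norm_inv, inv_pow, norm_ofReal_sub_sq]
      have h2 := him n
      refine inv_anti₀ (by positivity) ?_
      nlinarith
    calc ∑ n ∈ Finset.range N, ‖((t : ℂ) - u n)⁻¹‖ ^ 2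
        ≤ ∑ n ∈ Finset.range N,
          C * (Real.arctan ((u (n + 1)).re - t) - Real.arctan ((u n).re - t)) :=
          Finset.sum_le_sum fun n _ => h1 n
      _ = C * (Real.arctan ((u N).re - t) + Real.arctan t) := by
          rw [← Finset.mul_sum, Finset.sum_range_sub fun n => Real.arctan ((u n).re - t)]
          simp [hu0, Real.arctan_neg]
      _ ≤ C * (Real.pi / 2 + Real.arctan t) := by
          gcongr
          exact (Real.arctan_lt_pi_div_two _).le
  refine ⟨_, im_orbit_le_of_sum_le hν hpos hu
    (S := ∫ t, C * (Real.pi / 2 + Real.arctan t) ∂ν) fun N => ?_⟩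
  have hint : ∀ n ∈ Finset.range N, Integrable (fun t : ℝ => ‖((t : ℂ) - u n)⁻¹‖ ^ 2) ν :=
    fun n _ => integrable_norm_kernel_sq hν (hpos n)
  simp only [kernelNormSq]
  rw [← integral_finsetSum _ hint]
  exact integral_mono (integrable_finsetSum _ hint)
    ((integrable_pi_div_two_add_arctan hν hfin).const_mul C) (hbound N)

end Bounded

/-! ### Nevanlinna representations with finite first moment -/

/-- The measure `(1 + t²) dμ(t)`. -/
noncomputable def secondMomentMeasure (μ : Measure ℝ) : Measure ℝ :=
  μ.withDensity fun t => ((1 + t ^ 2).toNNReal : ENNReal)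

section Representation

variable {μ : Measure ℝ}

lemma measurable_one_add_sq_toNNReal : Measurable fun t : ℝ => (1 + t ^ 2).toNNReal := by fun_prop

lemma integrable_secondMomentMeasure_iff {E : Type*} [NormedAddCommGroup E] [NormedSpace ℝ E]
    {g : ℝ → E} :
    Integrable g (secondMomentMeasure μ) ↔ Integrable (fun t => (1 + t ^ 2) • g t) μ := by
  rw [secondMomentMeasure, integrable_withDensity_iff_integrable_smul measurable_one_add_sq_toNNReal]
  refine integrable_congr (Eventually.of_forall fun t => ?_)
  simp only [NNReal.smul_def, Real.coe_toNNReal _ (show 0 ≤ 1 + t ^ 2 by positivity)]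

lemma integral_secondMomentMeasure {E : Type*} [NormedAddCommGroup E] [NormedSpace ℝ E]
    (g : ℝ → E) : ∫ t, g t ∂secondMomentMeasure μ = ∫ t, (1 + t ^ 2) • g t ∂μ := by
  rw [secondMomentMeasure, integral_withDensity_eq_integral_smul measurable_one_add_sq_toNNReal]
  congr 1 with t
  simp only [NNReal.smul_def, Real.coe_toNNReal _ (show 0 ≤ 1 + t ^ 2 by positivity)]

lemma integrable_weight_secondMomentMeasure [IsFiniteMeasure μ]
    (hL1 : Integrable (fun t : ℝ => t) μ) :
    Integrable (fun t : ℝ => (1 + |t|)⁻¹) (secondMomentMeasure μ) := by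
  rw [integrable_secondMomentMeasure_iff]
  refine ((integrable_const (1 : ℝ)).add hL1.abs).mono'
    (Measurable.aestronglyMeasurable (by fun_prop)) (Eventually.of_forall fun t => ?_)
  rw [Real.norm_of_nonneg (by positivity), smul_eq_mul, ← div_eq_mul_inv,
    div_le_iff₀ (by positivity), Pi.add_apply]
  nlinarith [abs_nonneg t, sq_abs t]

lemma secondMomentMeasure_lt_top_iff [IsFiniteMeasure μ] {s : Set ℝ} (hs : MeasurableSet s) :
    secondMomentMeasure μ s < ⊤ ↔ IntegrableOn (fun t : ℝ => t ^ 2) s μ := by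
  have h1 : secondMomentMeasure μ s < ⊤ ↔ IntegrableOn (fun t : ℝ => 1 + t ^ 2) s μ := by
    rw [secondMomentMeasure, withDensity_apply _ hs, IntegrableOn, Integrable,
      hasFiniteIntegral_iff_ofReal (Eventually.of_forall fun t => by positivity)]
    exact ⟨fun h => ⟨Measurable.aestronglyMeasurable (by fun_prop), h⟩, fun h => h.2⟩
  rw [h1]
  have hc : IntegrableOn (fun _ : ℝ => (1 : ℝ)) s μ := integrable_const _
  refine ⟨fun h => ?_, fun h => hc.add h⟩
  exact Integrable.congr (h.sub hc) (Eventually.of_forall fun t => by simp)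

/-- A Nevanlinna representation with finite first moment is a `pickMap`. -/
lemma eq_pickMap_secondMomentMeasure [IsFiniteMeasure μ] (hL1 : Integrable (fun t : ℝ => t) μ)
    (β : ℝ) {z : ℂ} (hz : 0 < z.im) :
    z + β + ∫ t : ℝ, (1 + (t : ℂ) * z) / ((t : ℂ) - z) ∂μ =
      pickMap (secondMomentMeasure μ) (β - ∫ t, t ∂μ) z := by
  have hint := integrable_secondMomentMeasure_iff.1
    (integrable_kernel (integrable_weight_secondMomentMeasure hL1) hz)
  -- Pointwise, `(1 + t z) / (t - z) = (1 + t²) / (t - z) - t`.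
  have h : ∫ t : ℝ, (1 + (t : ℂ) * z) / ((t : ℂ) - z) ∂μ =
      cauchyTransform (secondMomentMeasure μ) z - ((∫ t, t ∂μ : ℝ) : ℂ) := by
    have hL : Integrable (fun t : ℝ => (t : ℂ)) μ := hL1.ofReal
    rw [cauchyTransform, integral_secondMomentMeasure, ← integral_complex_ofReal,
      ← integral_sub hint hL]
    congr 1 with t
    have := ofReal_sub_ne_zero hz t
    rw [Complex.real_smul]
    push_cast
    field_simp
    ring
  rw [h, pickMap]
  push_cast
  ring

end Representation

/-! ### Transfer to self-maps of the half-plane -/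

lemma coe_iterate_eq_iterate {f : ℍ → ℍ} {F : ℂ → ℂ} (h : ∀ z : ℍ, (f z : ℂ) = F z) (n : ℕ)
    (z : ℍ) : ((f^[n] z : ℍ) : ℂ) = F^[n] z := by
  induction n with
  | zero => rfl
  | succ n ih => rw [Function.iterate_succ_apply', Function.iterate_succ_apply', h, ih]

lemma HasDenjoyWolffPointInfty.tendsto_norm {f : ℍ → ℍ} (hf : HasDenjoyWolffPointInfty f) (z : ℍ) :
    Tendsto (fun n => ‖((f^[n] z : ℍ) : ℂ)‖) atTop atTop := by
  refine tendsto_atTop.2 fun R => ?_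
  filter_upwards [hf {z} isCompact_singleton R] with n hn
  exact hn z rfl

/-- An orbit that stalls once is constant afterwards and cannot escape. -/
lemma iterate_succ_ne_of_tendsto_norm {F : ℂ → ℂ} {z : ℂ}
    (h : Tendsto (fun n => ‖F^[n] z‖) atTop atTop) (n : ℕ) : F^[n + 1] z ≠ F^[n] z := by
  intro heq
  have hconst : ∀ m, n ≤ m → F^[m] z = F^[n] z := by
    intro m hm
    induction m, hm using Nat.le_induction with
    | base => rfl
    | succ m hm ih => rw [Function.iterate_succ_apply', ih, ← Function.iterate_succ_apply' F, heq]
  obtain ⟨m, hm1, hm2⟩ := ((h.eventually_gt_atTop ‖F^[n] z‖).and (eventually_ge_atTop n)).exists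
  rw [hconst m hm2] at hm1
  exact lt_irrefl _ hm1

section PickMap

variable {ν : Measure ℝ} {b : ℝ} {f : ℍ → ℍ}

lemma hasZeroHyperbolicStep_iff_exists (hf : ∀ z : ℍ, (f z : ℂ) = pickMap ν b z) :
    HasZeroHyperbolicStep f ↔ ∃ z : ℍ,
      Tendsto (fun n => hypRatio ((pickMap ν b)^[n + 1] z) ((pickMap ν b)^[n] z)) atTop (𝓝 0) := by
  simp only [HasZeroHyperbolicStep, tendsto_pseudoHyperbolicDist_iff, coe_iterate_eq_iterate hf]

lemma hasZeroHyperbolicStep_iff_tendsto_im (hν : Integrable (fun t : ℝ => (1 + |t|)⁻¹) ν)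
    (hf : ∀ z : ℍ, (f z : ℂ) = pickMap ν b z) (hdw : HasDenjoyWolffPointInfty f) (z : ℍ) :
    HasZeroHyperbolicStep f ↔ Tendsto (fun n => ((pickMap ν b)^[n] z).im) atTop atTop := by
  have hne : ∀ (w : ℍ) (n : ℕ), (pickMap ν b)^[n + 1] w ≠ (pickMap ν b)^[n] w := fun w =>
    iterate_succ_ne_of_tendsto_norm (by
      simpa only [coe_iterate_eq_iterate hf] using hdw.tendsto_norm w)
  rw [hasZeroHyperbolicStep_iff_exists hf]
  constructor
  · rintro ⟨w, hw⟩
    exact tendsto_im_iterate_of_tendsto hν b w.im_pos z.im_pos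
      ((tendsto_step_zero_iff hν b w.im_pos (hne w)).1 hw)
  · exact fun h => ⟨z, (tendsto_step_zero_iff hν b z.im_pos (hne z)).2 h⟩

lemma not_tendsto_im_iff (hν : Integrable (fun t : ℝ => (1 + |t|)⁻¹) ν) {z : ℂ} (hz : 0 < z.im) :
    ¬ Tendsto (fun n => ((pickMap ν b)^[n] z).im) atTop atTop ↔
      ∃ L, ∀ n, ((pickMap ν b)^[n] z).im ≤ L := by
  constructor
  · intro h
    obtain ⟨l, hl⟩ := (tendsto_atTop_of_monotone (monotone_im_of_orbit hν (b := b)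
      (im_iterate_pickMap_pos hν b hz) fun n => Function.iterate_succ_apply' _ _ _)).resolve_left h
    obtain ⟨L, hL⟩ := hl.bddAbove_range
    exact ⟨L, fun n => hL ⟨n, rfl⟩⟩
  · rintro ⟨L, hL⟩ h
    obtain ⟨n, hn⟩ := (h.eventually_gt_atTop L).exists
    exact hn.not_ge (hL n)

lemma hasPositiveHyperbolicStep_iff_exists_im_le (hν : Integrable (fun t : ℝ => (1 + |t|)⁻¹) ν)
    (hf : ∀ z : ℍ, (f z : ℂ) = pickMap ν b z) (hdw : HasDenjoyWolffPointInfty f) (z : ℍ) :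
    HasPositiveHyperbolicStep f ↔ ∃ L, ∀ n, ((pickMap ν b)^[n] z).im ≤ L := by
  rw [HasPositiveHyperbolicStep, hasZeroHyperbolicStep_iff_tendsto_im hν hf hdw z,
    not_tendsto_im_iff hν z.im_pos]

/-- The height criterion may be tested on any single orbit: that of `i` for necessity, that of a
high point `iY` for sufficiency. -/
lemma hasPositiveHyperbolicStep_iff_of_pos (hν : Integrable (fun t : ℝ => (1 + |t|)⁻¹) ν)
    (hf : ∀ z : ℍ, (f z : ℂ) = pickMap ν b z) (hdw : HasDenjoyWolffPointInfty f) (hb : 0 < b) :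
    HasPositiveHyperbolicStep f ↔ ν (Set.Ioi 0) < ⊤ := by
  constructor
  · intro h
    obtain ⟨L, hL⟩ := (hasPositiveHyperbolicStep_iff_exists_im_le hν hf hdw I).1 h
    exact measure_Ioi_lt_top_of_im_le hν hb (im_iterate_pickMap_pos hν b I.im_pos)
      (fun n => Function.iterate_succ_apply' _ _ _) hL
      (by simpa only [coe_iterate_eq_iterate hf] using hdw.tendsto_norm I)
  · intro h
    obtain ⟨Y, hY, hYL⟩ := exists_im_le_of_measure_Ioi_lt_top hν hb h
    have hpos : 0 < ((Y : ℂ) * Complex.I).im := by simpa using hY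
    exact (hasPositiveHyperbolicStep_iff_exists_im_le hν hf hdw ⟨_, hpos⟩).2
      (hYL (fun n => (pickMap ν b)^[n] (Y * Complex.I)) rfl (im_iterate_pickMap_pos hν b hpos)
        fun n => Function.iterate_succ_apply' _ _ _)

lemma hasPositiveHyperbolicStep_iff_of_neg (hν : Integrable (fun t : ℝ => (1 + |t|)⁻¹) ν)
    (hf : ∀ z : ℍ, (f z : ℂ) = pickMap ν b z) (hdw : HasDenjoyWolffPointInfty f) (hb : b < 0) :
    HasPositiveHyperbolicStep f ↔ ν (Set.Iio 0) < ⊤ := by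
  have hν' := integrable_weight_map_neg hν
  rw [← map_neg_Ioi]
  have horbit : ∀ (z : ℂ) (n : ℕ), -conj ((pickMap ν b)^[n + 1] z) =
      pickMap (ν.map fun t => -t) (-b) (-conj ((pickMap ν b)^[n] z)) := fun z n => by
    rw [pickMap_map_neg, Function.iterate_succ_apply']
  constructor
  · intro h
    obtain ⟨L, hL⟩ := (hasPositiveHyperbolicStep_iff_exists_im_le hν hf hdw I).1 h
    refine measure_Ioi_lt_top_of_im_le hν' (neg_pos.2 hb)
      (u := fun n => -conj ((pickMap ν b)^[n] (I : ℂ))) (L := L) (fun n => ?_) (horbit I)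
      (fun n => ?_) ?_
    · simpa using im_iterate_pickMap_pos hν b I.im_pos n
    · simpa using hL n
    · simpa only [norm_neg, Complex.norm_conj, coe_iterate_eq_iterate hf] using hdw.tendsto_norm I
  · intro h
    obtain ⟨Y, hY, hYL⟩ := exists_im_le_of_measure_Ioi_lt_top hν' (neg_pos.2 hb) h
    have hpos : 0 < ((Y : ℂ) * Complex.I).im := by simpa using hY
    refine (hasPositiveHyperbolicStep_iff_exists_im_le hν hf hdw ⟨_, hpos⟩).2 ?_
    simpa using hYL (fun n => -conj ((pickMap ν b)^[n] (Y * Complex.I))) (by simp)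
      (fun n => by simpa using im_iterate_pickMap_pos hν b hpos n) (horbit _)

end PickMap

theorem mainTheorem1 (f : ℍ → ℍ) (hf : IsParabolicAtInfty f)
    (β : ℝ) (μ : Measure ℝ) [IsFiniteMeasure μ]
    (hrep : ∀ z : ℍ,
      (f z : ℂ) = (z : ℂ) + (β : ℂ) + ∫ t : ℝ, (1 + (t : ℂ) * (z : ℂ)) / ((t : ℂ) - (z : ℂ)) ∂μ)
    (hL1 : Integrable (fun t : ℝ => t) μ) :
    (β = ∫ t : ℝ, t ∂μ → HasZeroHyperbolicStep f) ∧
    (∫ t : ℝ, t ∂μ < β →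
      (HasPositiveHyperbolicStep f ↔ IntegrableOn (fun t : ℝ => t ^ 2) (Set.Ioi 0) μ)) ∧
    (β < ∫ t : ℝ, t ∂μ →
      (HasPositiveHyperbolicStep f ↔ IntegrableOn (fun t : ℝ => t ^ 2) (Set.Iio 0) μ)) ∧
    (∀ z : ℍ, HasZeroHyperbolicStep f ↔
      Tendsto (fun n : ℕ => (f^[n] z).im) atTop atTop) := by
  have hν := integrable_weight_secondMomentMeasure hL1
  have hpick : ∀ z : ℍ, (f z : ℂ) = pickMap (secondMomentMeasure μ) (β - ∫ t, t ∂μ) z := fun z =>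
    (hrep z).trans (eq_pickMap_secondMomentMeasure hL1 β z.im_pos)
  refine ⟨fun h => ?_, fun h => ?_, fun h => ?_, fun z => ?_⟩
  · rw [hasZeroHyperbolicStep_iff_exists hpick]
    rw [sub_eq_zero.2 h]
    exact ⟨I, tendsto_step_zero_of_eq_zero hν I.im_pos⟩
  · rw [hasPositiveHyperbolicStep_iff_of_pos hν hpick hf.denjoyWolff (sub_pos.2 h),
      secondMomentMeasure_lt_top_iff measurableSet_Ioi]
  · rw [hasPositiveHyperbolicStep_iff_of_neg hν hpick hf.denjoyWolff (sub_neg.2 h),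
      secondMomentMeasure_lt_top_iff measurableSet_Iio]
  · rw [hasZeroHyperbolicStep_iff_tendsto_im hν hpick hf.denjoyWolff z]
    simp only [← coe_iterate_eq_iterate hpick, UpperHalfPlane.coe_im]
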